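/- **Setting.** Let $K$ be an $(n-1)$-dimensional star-shaped simplicial sphere with vertex set $[m]=\{1,\dots,m\}$, i.e. the underlying simplicial complex of a complete simplicial fan in $\mathbb R^n$, and let $J=(j_1,\dots,j_m)$ be a tuple of positive integers. Let $R$ be $\mathbb Z$ or $\mathbb Z_2=\mathbb Z/2\mathbb Z$. For a simplicial complex $L$ of dimension $d-1$, an $R$-characteristic map over $L$ is a map $\lambda\colon V(L)\to R^d$ such that for every face $\{i_1,\dots,i_d\}$ of $L$ with $d$ vertices the vectors $\lambda(i_1),\dots,\lambda(i_d)$ form a basis of $R^d$. Fix one of the following four categories of characteristic maps: (1) all $\mathbb Z$-characteristic maps; (2) positively oriented $\mathbb Z$-characteristic maps, i.e. those for which, for an orientation of $L$, the determinants $\det(\lambda(i_1),\dots,\lambda(i_d))$ of all positively ordered facets $(i_1,\dots,i_d)$ have the same sign; (3) fan-giving $\mathbb Z$-characteristic maps, i.e. those for which the cones spanned by $\{\lambda(i)\}_{i\in\sigma}$, $\sigma\in L$, form a complete fan in $\mathbb R^d$ with underlying complex $L$; (4) all $\mathbb Z_2$-characteristic maps. From now on every characteristic map is understood to lie in the chosen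 category. Two characteristic maps over $L$ are D-J equivalent if they differ by a change of basis of $R^d$; the equivalence classes are called D-J classes. For a face $\sigma$ of $L$, the projection $\operatorname{proj}_\sigma\lambda$ is the D-J class over $\operatorname{link}_L\sigma$ of the map $w\mapsto[\lambda(w)]\in R^d/\langle\lambda(v)\mid v\in\sigma\rangle\cong R^{d-|\sigma|}$. For a vertex $v$ of $K$, the wedge is $\operatorname{wed}_vK=(I\star\operatorname{link}_K\{v\})\cup(\partial I\star(K\setminus\{v\}))$, where $I$ is an edge with two new vertices $v_1,v_2$ and $K\setminus\{v\}$ is the subcomplex induced on the vertices other than $v$; the links of $v_1$ and of $v_2$ in it are naturally identified with $K$. The pre-diagram $D'(K)$ is the edge-colored pseudograph whose vertices are the D-J classes over $K$ and whose edges are the sets $\{\lambda_1,\lambda_2,v\}$ (an edge of color $v$ with endpoints $\lambda_1,\lambda_2$; loops are allowed) such that there is a characteristic map over $\operatorname{wed}_vK$ whose two projections, with respect to $v_1$ and $v_2$, are $\lambda_1$ and $\lambda_2$. Let $K(J)$ be the simplicial complex on the vertices $i_1,\dots,i_{j_i}$ $(1\le i\le m)$ whose minimal non-faces are the sets $\{i_a\mid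 i\in\tau,\ 1\le a\le j_i\}$ for the minimal non-faces $\tau$ of $K$; it has dimension $n-1+\sum_i(j_i-1)$. Let $G(J)$ be the 1-skeleton of $\Delta^{j_1-1}\times\dots\times\Delta^{j_m-1}$. Its vertices are the tuples $\alpha=(\alpha_1,\dots,\alpha_m)$ with $1\le\alpha_i\le j_i$; two of them are joined by an edge of color $v$ if they differ in the $v$-th coordinate and in no other. A *puzzle* of $(K,J)$ is a color-preserving graph homomorphism $p\colon G(J)\to D'(K)$. For a vertex $\alpha$ of $G(J)$ let $\sigma(\alpha)$ be the face of $K(J)$ consisting of all vertices except $1_{\alpha_1},\dots,m_{\alpha_m}$; its link is identified with $K$ by $i_{\alpha_i}\leftrightarrow i$. The puzzle $p$ is *realizable* if there is a characteristic map $\lambda$ over $K(J)$ with $p(\alpha)=\operatorname{proj}_{\sigma(\alpha)}\lambda$ for every vertex $\alpha$ of $G(J)$. A *subsquare* of $p$ is the restriction of $p$ to the 1-skeleton of a face of $\prod_i\Delta^{j_i-1}$ that is the product of an edge of $\Delta^{j_v-1}$, an edge of $\Delta^{j_w-1}$ for some $w\neq v$, and a vertex of each other factor. It is regarded as a puzzle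 of $(K,J')$ with $j'_v=j'_w=2$ and all other $j'_i=1$, and it is called realizable if it is realizable as such. **Theorem 5.3.** In each of the four categories, a puzzle $p\colon G(J)\to D'(K)$ is realizable if and only if all of its subsquares are realizable. -/

import Mathlib

namespace ToricPuzzle

/-- An abstract simplicial complex with vertices in `V`, given by its set of faces: a family of
finite subsets of `V` closed under passing to subsets (the empty set counts as a face). -/
abbrev Cpx (V : Type) := LowerSet (Finset V)

namespace Cpx

variable {V : Type}

/-- A minimal non-face: not a face, while every proper subset is a face. -/
def IsMinNonface (K : Cpx V) (τ : Finset V) : Prop :=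
  τ ∉ K ∧ ∀ ρ : Finset V, ρ ⊂ τ → ρ ∈ K

/-- The link `{τ ∈ K | σ ∪ τ ∈ K, σ ∩ τ = ∅}` of `σ`. -/
def link [DecidableEq V] (K : Cpx V) (σ : Finset V) : Cpx V where
  carrier := {τ | τ ∈ K ∧ σ ∪ τ ∈ K ∧ Disjoint σ τ}
  lower' := fun _ _ hba ha =>
    ⟨K.lower hba ha.1, K.lower (Finset.union_subset_union_right hba) ha.2.1,
      ha.2.2.mono_right hba⟩

/-- The induced subcomplex on all vertices except `v`. -/
def deletion (K : Cpx V) (v : V) : Cpx V where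
  carrier := {τ | τ ∈ K ∧ v ∉ τ}
  lower' := fun _ _ hba ha => ⟨K.lower hba ha.1, fun h => ha.2 (hba h)⟩

/-- The full simplex on the vertex set `s`. -/
def simplex (s : Finset V) : Cpx V where
  carrier := {σ | σ ⊆ s}
  lower' := fun _ _ hba ha => Finset.Subset.trans hba ha

/-- The boundary of the simplex on `s`: all proper subsets of `s`. -/
def boundary (s : Finset V) : Cpx V where
  carrier := {σ | σ ⊂ s}
  lower' := fun _ _ hba ha => lt_of_le_of_lt hba ha

/-- The simplicial join `{σ ∪ τ | σ ∈ K, τ ∈ L}`. It is used only for complexes with disjoint sets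
of vertices. -/
def join [DecidableEq V] (K L : Cpx V) : Cpx V where
  carrier := {ρ | ∃ σ ∈ K, ∃ τ ∈ L, ρ = σ ∪ τ}
  lower' := by
    rintro _ b hba ⟨σ, hσ, τ, hτ, rfl⟩
    refine ⟨b ∩ σ, K.lower Finset.inter_subset_right hσ, b ∩ τ,
      L.lower Finset.inter_subset_right hτ, ?_⟩
    rw [← Finset.inter_union_distrib_left]
    exact (Finset.inter_eq_left.2 hba).symm

/-- The same complex with every vertex `w` renamed `some w`. -/
def mapSome (K : Cpx V) : Cpx (Option V) where
  carrier := {ρ | ∃ τ ∈ K, ρ = τ.map Function.Embedding.some}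
  lower' := by
    rintro _ b hba ⟨τ, hτ, rfl⟩
    obtain ⟨t, ht, rfl⟩ := Finset.subset_map_iff.1 hba
    exact ⟨t, K.lower ht hτ, rfl⟩

/-- The simplicial wedge `wed_v K = (I ⋆ link_K {v}) ∪ (∂I ⋆ (K ∖ {v}))`. Here `I` is the edge with
vertices `v₁ = some v` and `v₂ = none`, and any other vertex `w` of `K` is called `some w`. -/
def wedge [DecidableEq V] (K : Cpx V) (v : V) : Cpx (Option V) :=
  join (simplex {some v, none}) (mapSome (K.link {v})) ⊔
    join (boundary {some v, none}) (mapSome (K.deletion v))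

/-- The complex `K(J)` on the vertices `i_1, …, i_{J i}` for `i ∈ V` (the vertex `i_a` is `⟨i, a⟩`,
with `a` counted from `0`). Its minimal non-faces are the sets of all `i_a` with `i ∈ τ`, for `τ` a
minimal non-face of `K`; its faces are the sets that contain none of these. -/
def multiWedge (K : Cpx V) (J : V → ℕ) : Cpx (Σ i, Fin (J i)) where
  carrier := {S | ∀ τ, K.IsMinNonface τ → ¬ τ.sigma (fun _ => Finset.univ) ⊆ S}
  lower' := fun _ _ hba ha τ hτ h => ha τ hτ (Finset.Subset.trans h hba)

end Cpx

/-- The vectors `x v` span the rays of a complete simplicial fan in `ℝⁿ` with underlying complex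
`K`: the cones over the faces of `K` are simplicial, meet along common faces, and cover `ℝⁿ`. -/
structure IsCompleteFan {V : Type} {n : ℕ} (K : Cpx V) (x : V → Fin n → ℝ) : Prop where
  linearIndependent : ∀ σ ∈ K, LinearIndependent ℝ (fun v : σ => x v)
  inter : ∀ σ ∈ K, ∀ τ ∈ K,
    (PointedCone.hull ℝ (x '' (σ : Set V)) : Set (Fin n → ℝ)) ∩
      (PointedCone.hull ℝ (x '' (τ : Set V)) : Set (Fin n → ℝ)) =
      (PointedCone.hull ℝ (x '' ((σ : Set V) ∩ (τ : Set V))) : Set (Fin n → ℝ))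
  cover : ∀ y : Fin n → ℝ, ∃ σ ∈ K, y ∈ PointedCone.hull ℝ (x '' (σ : Set V))

/-- `K` is a star-shaped simplicial sphere of dimension `n - 1` with vertex set `V`: it is the
underlying complex of a complete simplicial fan in `ℝⁿ`, and each element of `V` is a vertex. -/
def IsStarShapedSphere {V : Type} (n : ℕ) (K : Cpx V) : Prop :=
  (∀ v : V, {v} ∈ K) ∧ ∃ x : V → Fin n → ℝ, IsCompleteFan K x

/-- A category of characteristic maps with coefficients in `R`: it says which maps `V → Rⁿ` are
objects over a complex with vertices in `V`. -/
def CharCat (R : Type) : Type 1 := ∀ (V : Type) (n : ℕ), Cpx V → (V → Fin n → R) → Prop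

/-- The non-singularity condition: the vectors on each face with `n` vertices form a basis
of `Rⁿ`. -/
def IsCharacteristic {R : Type} [CommRing R] {V : Type} {n : ℕ} (K : Cpx V)
    (l : V → Fin n → R) : Prop :=
  ∀ σ ∈ K, σ.card = n → LinearIndependent R (fun v : σ => l v) ∧
    Submodule.span R (l '' (σ : Set V)) = ⊤

/-- An ordered facet `s` of `K` is an enumeration of a face with `n` vertices. A coherent
orientation attaches a sign to every ordered facet: it is alternating, and it changes when one
vertex is replaced by another, so that the two facets share the remaining `n - 1` vertices. -/
structure IsOrientation {V : Type} {n : ℕ} (K : Cpx V) (ε : (Fin n ↪ V) → ℤˣ) : Prop where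
  perm : ∀ s : Fin n ↪ V, Finset.univ.map s ∈ K → ∀ π : Equiv.Perm (Fin n),
    ε (π.toEmbedding.trans s) = Equiv.Perm.sign π * ε s
  adjacent : ∀ s t : Fin n ↪ V, Finset.univ.map s ∈ K → Finset.univ.map t ∈ K →
    ∀ i : Fin n, s i ≠ t i → (∀ j, j ≠ i → s j = t j) → ε t = - ε s

/-- For a suitable orientation of `K` all determinants `det (l i₁, …, l iₙ)` over positively ordered
facets are positive; replacing an orientation by its opposite, this says that these determinants
have the same sign for all positively ordered facets. -/
def IsPositivelyOriented {V : Type} {n : ℕ} (K : Cpx V) (l : V → Fin n → ℤ) : Prop :=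
  ∃ ε : (Fin n ↪ V) → ℤˣ, IsOrientation K ε ∧
    ∀ s : Fin n ↪ V, Finset.univ.map s ∈ K → 0 < (ε s : ℤ) * Matrix.det (fun i => l (s i))

/-- The vectors `l v` generate the rays of a complete fan whose underlying complex is `K`. -/
def IsFanGiving {V : Type} {n : ℕ} (K : Cpx V) (l : V → Fin n → ℤ) : Prop :=
  IsCompleteFan K (fun v i => (l v i : ℝ))

/-- The category of `ℤ`-characteristic maps. -/
def intCat : CharCat ℤ := fun _ _ K l => IsCharacteristic K l

/-- The category of positively oriented `ℤ`-characteristic maps. -/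
def posCat : CharCat ℤ := fun _ _ K l => IsCharacteristic K l ∧ IsPositivelyOriented K l

/-- The category of fan-giving `ℤ`-characteristic maps. -/
def fanCat : CharCat ℤ := fun _ _ K l => IsCharacteristic K l ∧ IsFanGiving K l

/-- The category of `ℤ₂`-characteristic maps. -/
def modTwoCat : CharCat (ZMod 2) := fun _ _ K l => IsCharacteristic K l

section Classes

variable {R : Type} [CommRing R] {V : Type}

/-- The characteristic maps over `K` in the category `C`, with values in `Rⁿ`. -/
abbrev CharMap (C : CharCat R) (n : ℕ) (K : Cpx V) : Type := {l : V → Fin n → R // C V n K l}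

/-- Davis–Januszkiewicz equivalence: equality up to a change of basis of `Rⁿ`. -/
def djSetoid (C : CharCat R) (n : ℕ) (K : Cpx V) : Setoid (CharMap C n K) where
  r l₁ l₂ := ∃ g : (Fin n → R) ≃ₗ[R] (Fin n → R), ∀ v, l₂.1 v = g (l₁.1 v)
  iseqv :=
    { refl := fun _ => ⟨LinearEquiv.refl R _, fun _ => rfl⟩
      symm := by
        rintro l₁ l₂ ⟨g, hg⟩
        exact ⟨g.symm, fun v => by rw [hg v, LinearEquiv.symm_apply_apply]⟩
      trans := by
        rintro l₁ l₂ l₃ ⟨g, hg⟩ ⟨h, hh⟩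
        exact ⟨g.trans h, fun v => by rw [hh v, hg v, LinearEquiv.trans_apply]⟩ }

/-- Davis–Januszkiewicz classes over `K` in the category `C`. -/
abbrev DJClass (C : CharCat R) (n : ℕ) (K : Cpx V) : Type := Quotient (djSetoid C n K)

/-- Let `L : W → Rᴺ`, let `σ` be a face of a complex on `W`, and let `f : V → W` identify `V` with
the vertices of the link of `σ`. Then `HasProj L σ f c` says that the class `c` is the projection
of `L` with respect to `σ`: some isomorphism of `Rᴺ / ⟨L w | w ∈ σ⟩` with `Rⁿ` turns `v ↦ [L (f v)]`
into a representative of `c`. -/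
def HasProj {C : CharCat R} {n N : ℕ} {K : Cpx V} {W : Type} (L : W → Fin N → R) (σ : Finset W)
    (f : V → W) (c : DJClass C n K) : Prop :=
  ∃ l : CharMap C n K, Quotient.mk (djSetoid C n K) l = c ∧
    ∃ e : ((Fin N → R) ⧸ Submodule.span R (L '' (σ : Set W))) ≃ₗ[R] (Fin n → R),
      ∀ v, l.1 v = e (Submodule.Quotient.mk (L (f v)))

end Classes

/-- An edge-colored pseudograph (loops are allowed) with vertices `A` and colors `Γ`: a set of
triples `{a, b, γ}` of two endpoints and a color. -/
structure ColoredGraph (A Γ : Type) where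
  edges : Set (Sym2 A × Γ)

/-- The color-preserving graph homomorphisms. -/
structure ColoredGraph.Hom {A B Γ : Type} (G : ColoredGraph A Γ) (H : ColoredGraph B Γ) where
  toFun : A → B
  map_edges : ∀ (e : Sym2 A) (γ : Γ), (e, γ) ∈ G.edges → (Sym2.map toFun e, γ) ∈ H.edges

/-- The graph `G(J)`: the 1-skeleton of `∏ i, Δ^{J i - 1}`. The simplex `Δ^{J i - 1}` has the vertex
set `Fin (J i)`; an edge of color `v` joins two vertices of the product that differ in the
`v`-th coordinate and in no other one. -/
def boardGraph {V : Type} (J : V → ℕ) : ColoredGraph (∀ i, Fin (J i)) V where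
  edges := {x | ∃ α β : ∀ i, Fin (J i), x.1 = s(α, β) ∧ α x.2 ≠ β x.2 ∧ ∀ w, w ≠ x.2 → α w = β w}

section Puzzle

variable {R : Type} [CommRing R] {V : Type} [DecidableEq V]

/-- The pre-diagram `D'(K)`: its vertices are the D-J classes over `K`, and `{c₁, c₂, v}` is an edge
if some characteristic map over `wed_v K` has the two projections `c₁`, `c₂` with respect to the
vertices `v₁ = some v` and `v₂ = none`. The link of `v₁` is identified with `K` by naming the vertex
`v₂` of it `v`, and the link of `v₂` by naming the vertex `v₁` of it `v`. -/
def preDiagram (C : CharCat R) (n : ℕ) (K : Cpx V) : ColoredGraph (DJClass C n K) V where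
  edges := {x | ∃ c₁ c₂ : DJClass C n K, x.1 = s(c₁, c₂) ∧
    ∃ L : CharMap C (n + 1) (K.wedge x.2),
      HasProj L.1 {some x.2} (fun w => if w = x.2 then none else some w) c₁ ∧
      HasProj L.1 {none} (fun w => some w) c₂}

/-- A puzzle of the pair `(K, J)`. -/
abbrev Puzzle (C : CharCat R) (n : ℕ) (K : Cpx V) (J : V → ℕ) : Type :=
  ColoredGraph.Hom (boardGraph J) (preDiagram C n K)

/-- The face `σ(α)` of `K(J)`: all vertices except the `i_{α i}`. -/
def complFace [Fintype V] {J : V → ℕ} (α : ∀ i, Fin (J i)) : Finset (Σ i, Fin (J i)) :=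
  Finset.univ.filter (fun x => x.2 ≠ α x.1)

/-- A puzzle is realizable if it comes from a characteristic map `L` over `K(J)` (a complex of
dimension `n - 1 + ∑ (J i - 1)`): its value at each vertex `α` of `G(J)` is the projection of `L`
with respect to `σ(α)`. The link of `σ(α)` is identified with `K` by `i ↦ i_{α i}`. -/
def Puzzle.IsRealizable [Fintype V] {C : CharCat R} {n : ℕ} {K : Cpx V} {J : V → ℕ}
    (p : Puzzle C n K J) : Prop :=
  ∃ L : CharMap C (n + ∑ i, (J i - 1)) (K.multiWedge J),
    ∀ α : ∀ i, Fin (J i), HasProj L.1 (complFace α) (fun i => ⟨i, α i⟩) (p.toFun α)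

/-- The subpuzzle of `p` on a face of `∏ i, Δ^{J i - 1}`, regarded as a puzzle of `(K, J')`. The face
is the product of the faces of the `Δ^{J i - 1}` with the `J' i` vertices in the range of `φ i`. -/
def Puzzle.sub {C : CharCat R} {n : ℕ} {K : Cpx V} {J J' : V → ℕ} (p : Puzzle C n K J)
    (φ : ∀ i, Fin (J' i) ↪o Fin (J i)) : Puzzle C n K J' where
  toFun α := p.toFun (fun i => φ i (α i))
  map_edges := by
    rintro e γ ⟨α, β, he, hne, heq⟩
    obtain rfl : e = s(α, β) := he
    exact p.map_edges s(fun i => φ i (α i), fun i => φ i (β i)) γ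
      ⟨_, _, rfl, fun h => hne ((φ γ).injective h), fun w hw => congrArg (φ w) (heq w hw)⟩

/-- `∏ i, Δ^{J i - 1}` is a hypercube `(Δ¹)ᵈ`: `d` of the factors are edges, the other ones are
points. -/
def IsHypercube [Fintype V] (d : ℕ) (J : V → ℕ) : Prop :=
  (∀ i, J i = 1 ∨ J i = 2) ∧ (Finset.univ.filter (fun i => J i = 2)).card = d

/-- All subsquares of `p` are realizable. -/
def Puzzle.SubsquaresRealizable [Fintype V] {C : CharCat R} {n : ℕ} {K : Cpx V} {J : V → ℕ}
    (p : Puzzle C n K J) : Prop :=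
  ∀ J' : V → ℕ, IsHypercube 2 J' → ∀ φ : ∀ i, Fin (J' i) ↪o Fin (J i),
    Puzzle.IsRealizable (Puzzle.sub p φ)

end Puzzle

end ToricPuzzle

/-!
A characteristic map is determined up to a change of basis by its module of linear relations
`rel R l`, a submodule of `V → R` (the Gale dual). A set `S` of vertices carries a basis if and only
if the coordinates outside `S` are free coordinates on this module (`IsCobasis`). Projecting a map
over `K(J)` with respect to `σ(α)` restricts its relations to the vertices `i_{α i}`, and the facets
of `K(J)` are the joins of the `σ(α)` with facets of `K`. Hence a realization of a puzzle is the same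
as a module of functions on the vertices of `K(J)` that restricts isomorphically, for each `α`, to
the relations of the class at `α` (`Puzzle.isRealizable_of_relations`).

Such a module passes to subpuzzles by restriction. Conversely, consider all functions whose
restrictions are relations at every `α`. An edge of color `v` says that the relations at its two ends
agree up to their coefficient at `v`, and this coefficient is determined by the other ones. So a
relation at one vertex `α₀` has a unique candidate for an extension, read off from the neighbors of
`α₀`; the realizable squares show, by induction on the distance from `α₀`, that its restrictions are
relations everywhere (`Puzzle.exists_global_relation`). This settles the problem for categories that
lift to `K(J)` (`Lifts`): a map over `K(J)` whose projections all lie in the category lies in it too.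

For all `ℤ`- or `ℤ₂`-characteristic maps nothing remains to be shown. Positive orientation means that
adjacent facets lie on opposite sides of their common wall (`IsOpposite`). Most walls of `K(J)` are
walls of some projection; the others separate two facets over the same facet of `K`, and the sign
there is transported through the walls of `K` to a facet where two projections decide it
(`IsOpposite.multiWedge`).

For fans one moves a generic vector along a line: when it leaves a cone through a wall, it enters the
cone on the other side, so all generic vectors are covered by the same number of cones
(`IsCrossing.coverCount_eq`). This shows that the facets of a complete fan are connected through
walls, and that a configuration with opposite sides at all walls is a complete fan as soon as some
generic vector is covered at most once (`IsLocalFan.isCompleteFan`). Over `K(J)` the covering number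
is that of a single projection (`coverCount_le_one`).
-/

namespace ToricPuzzle

/-! ### Linear relations of a configuration -/

section LinearAlgebra

variable {R : Type} [CommRing R] {V W : Type} {E : Type} [AddCommGroup E] [Module R E]

theorem sum_eq_sum_of_supported [Fintype W] {F : Finset W} {c : W → R} (hc : ∀ w, w ∉ F → c w = 0)
    (x : W → E) : ∑ w, c w • x w = ∑ w ∈ F, c w • x w :=
  (Finset.sum_subset (Finset.subset_univ F) fun w _ hw => by rw [hc w hw, zero_smul]).symm

theorem linearIndependent_iff_supported [Fintype W] (F : Finset W) (x : W → E) :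
    LinearIndependent R (fun v : F => x v) ↔
      ∀ c : W → R, (∀ w, w ∉ F → c w = 0) → ∑ w, c w • x w = 0 → c = 0 := by
  have key : LinearIndependent R (fun v : F => x v) ↔ LinearIndepOn R x (F : Set W) := Iff.rfl
  rw [key, linearIndepOn_finset_iff]
  constructor
  · intro h c hc hs
    rw [sum_eq_sum_of_supported hc] at hs
    funext w
    by_cases hw : w ∈ F
    · exact h c hs w hw
    · exact hc w hw
  · classical
    intro h f hf w hw
    have := h (fun v => if v ∈ F then f v else 0) (fun v hv => if_neg hv) (by
      rw [sum_eq_sum_of_supported (F := F) (fun v hv => if_neg hv), ← hf]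
      exact Finset.sum_congr rfl fun v hv => by rw [if_pos hv])
    simpa [hw] using congrFun this w

theorem mem_span_image_iff_supported [Fintype W] (F : Finset W) (x : W → E) (y : E) :
    y ∈ Submodule.span R (x '' (F : Set W)) ↔
      ∃ c : W → R, (∀ w, w ∉ F → c w = 0) ∧ ∑ w, c w • x w = y := by
  classical
  rw [Submodule.mem_span_image_finset_iff_exists_fun]
  constructor
  · rintro ⟨c, hc⟩
    refine ⟨fun w => if h : w ∈ F then c ⟨w, h⟩ else 0, fun w hw => dif_neg hw, ?_⟩
    rw [sum_eq_sum_of_supported (F := F) (fun v hv => dif_neg hv), ← hc, ← Finset.sum_coe_sort F]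
    exact Finset.sum_congr rfl fun v _ => by rw [dif_pos v.2]
  · rintro ⟨c, hc, rfl⟩
    refine ⟨fun v => c v, ?_⟩
    rw [sum_eq_sum_of_supported hc]
    exact Finset.sum_coe_sort F (fun v => c v • x v)

/-- The module of linear relations `∑ c w • l w = 0` between the vectors of a configuration.
It is the Gale dual of the configuration, as a submodule of `W → R`. -/
def rel (R : Type) [CommRing R] {W : Type} [Fintype W] {E : Type} [AddCommGroup E] [Module R E]
    (l : W → E) : Submodule R (W → R) :=
  LinearMap.ker (Fintype.linearCombination R l)

theorem mem_rel [Fintype W] {l : W → E} {c : W → R} : c ∈ rel R l ↔ ∑ w, c w • l w = 0 := by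
  rw [rel, LinearMap.mem_ker, Fintype.linearCombination_apply]

/-- The vectors in the complement of `F` have free coordinates in `M`: every family of values
outside `F` extends to exactly one element of `M`. For `M = rel R l` this says that `l` restricts to
a basis on `F`. -/
def IsCobasis (M : Submodule R (W → R)) (F : Finset W) : Prop :=
  ∀ u : W → R, ∃! c, c ∈ M ∧ ∀ w, w ∉ F → c w = u w

theorem IsCobasis.eq_zero {M : Submodule R (W → R)} {F : Finset W} (h : IsCobasis M F)
    {c : W → R} (hc : c ∈ M) (h0 : ∀ w, w ∉ F → c w = 0) : c = 0 :=
  (h 0).unique ⟨hc, h0⟩ ⟨M.zero_mem, fun _ _ => rfl⟩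

/-- The vectors `l w` span the whole module, stated with coefficient functions on all of `W`. -/
def Spans (R : Type) [CommRing R] {W : Type} [Fintype W] {E : Type} [AddCommGroup E] [Module R E]
    (l : W → E) : Prop :=
  ∀ y : E, ∃ c : W → R, ∑ w, c w • l w = y

theorem isCobasis_rel [Fintype W] {l : W → E} {F : Finset W}
    (hli : LinearIndependent R (fun v : F => l v))
    (hsp : Submodule.span R (l '' (F : Set W)) = ⊤) : IsCobasis (rel R l) F := by
  classical
  rw [linearIndependent_iff_supported] at hli
  intro u
  obtain ⟨a, ha, hs⟩ := (mem_span_image_iff_supported F l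
    (∑ w, (if w ∈ F then 0 else u w) • l w)).1 (hsp ▸ Submodule.mem_top)
  refine ⟨fun w => (if w ∈ F then 0 else u w) - a w, ⟨?_, ?_⟩, ?_⟩
  · rw [mem_rel]
    simp only [sub_smul, Finset.sum_sub_distrib, hs, sub_self]
  · intro w hw
    simp [hw, ha w hw]
  · rintro c ⟨hc, hcu⟩
    refine eq_of_sub_eq_zero (hli _ ?_ ?_)
    · intro w hw
      simp [hw, ha w hw, hcu w hw]
    · rw [mem_rel] at hc
      simp only [Pi.sub_apply, sub_smul, Finset.sum_sub_distrib, hs, hc, sub_self]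

theorem spans_of_span_eq_top [Fintype W] {l : W → E} {F : Finset W}
    (hsp : Submodule.span R (l '' (F : Set W)) = ⊤) : Spans R l := fun y => by
  obtain ⟨c, -, hc⟩ := (mem_span_image_iff_supported (R := R) F l y).1 (hsp ▸ Submodule.mem_top)
  exact ⟨c, hc⟩

theorem IsCobasis.linearIndependent [Fintype W] {l : W → E} {F : Finset W}
    (h : IsCobasis (rel R l) F) : LinearIndependent R (fun v : F => l v) := by
  rw [linearIndependent_iff_supported]
  exact fun c hc hs => h.eq_zero (mem_rel.2 hs) hc

theorem IsCobasis.span_eq_top [Fintype W] {l : W → E} {F : Finset W}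
    (h : IsCobasis (rel R l) F) (hl : Spans R l) :
    Submodule.span R (l '' (F : Set W)) = ⊤ := by
  refine eq_top_iff.2 fun y _ => ?_
  obtain ⟨c, rfl⟩ := hl y
  obtain ⟨d, ⟨hd, hdc⟩, -⟩ := h c
  rw [mem_span_image_iff_supported]
  refine ⟨c - d, fun w hw => by simp [hdc w hw], ?_⟩
  rw [mem_rel] at hd
  simp only [Pi.sub_apply, sub_smul, Finset.sum_sub_distrib, hd, sub_zero]

theorem rel_equiv_comp [Fintype W] (l : W → E) (g : E ≃ₗ[R] E) : rel R (fun w => g (l w)) = rel R l := by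
  ext c
  rw [mem_rel, mem_rel, ← map_eq_zero_iff g g.injective (x := ∑ w, c w • l w), map_sum]
  simp only [map_smul]

/-- Every submodule that has a cobasis of the right size is the relation module of a
configuration. -/
theorem exists_rel_eq [Fintype W] {M : Submodule R (W → R)} {F : Finset W} {N : ℕ}
    (hF : F.card = N) (h : IsCobasis M F) :
    ∃ L : W → Fin N → R, rel R L = M ∧ Spans R L := by
  classical
  -- `R ^ F` maps isomorphically onto the quotient of `R ^ W` by `M`
  let ι : (F → R) →ₗ[R] (W → R) :=
    { toFun := fun a w => if h : w ∈ F then a ⟨w, h⟩ else 0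
      map_add' := fun a b => by
        funext w
        by_cases hw : w ∈ F <;> simp [hw]
      map_smul' := fun r a => by
        funext w
        by_cases hw : w ∈ F <;> simp [hw] }
  have hι : ∀ a w, w ∉ F → ι a w = 0 := fun a w hw => dif_neg hw
  have hι' : ∀ a (w : F), ι a w = a w := fun a w => dif_pos w.2
  have hbij : Function.Bijective (M.mkQ ∘ₗ ι) := by
    constructor
    · rw [← LinearMap.ker_eq_bot, LinearMap.ker_eq_bot']
      intro a ha
      have : ι a ∈ M := (Submodule.Quotient.mk_eq_zero M).1 ha
      have h0 := h.eq_zero this (hι a)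
      funext w
      rw [← hι' a w, h0]
      rfl
    · intro q
      obtain ⟨c, rfl⟩ := Submodule.Quotient.mk_surjective M q
      obtain ⟨d, ⟨hd, hdc⟩, -⟩ := h c
      refine ⟨fun w => c w - d w, ?_⟩
      refine (Submodule.Quotient.eq M).2 ?_
      have : ι (fun w => c w - d w) - c = -d := by
        funext w
        by_cases hw : w ∈ F
        · have := hι' (fun w => c w - d w) ⟨w, hw⟩
          simp only at this
          simp [this]
        · simp [hι _ w hw, hdc w hw]
      rw [this]
      exact M.neg_mem hd
  let e : (F → R) ≃ₗ[R] ((W → R) ⧸ M) := LinearEquiv.ofBijective _ hbij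
  let r : (F → R) ≃ₗ[R] (Fin N → R) := LinearEquiv.funCongrLeft R R (F.equivFinOfCardEq hF).symm
  let T : (W → R) →ₗ[R] (Fin N → R) := (e.symm.trans r).toLinearMap ∘ₗ M.mkQ
  have hT : ∀ c : W → R, ∑ w, c w • T (Pi.single w 1) = T c := by
    intro c
    conv_rhs => rw [pi_eq_sum_univ' c]
    rw [map_sum]
    simp only [map_smul]
  refine ⟨fun w => T (Pi.single w 1), ?_, fun y => ?_⟩
  · ext c
    rw [mem_rel, hT]
    change (e.symm.trans r) (M.mkQ c) = 0 ↔ _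
    rw [map_eq_zero_iff _ (e.symm.trans r).injective]
    exact Submodule.Quotient.mk_eq_zero M
  · obtain ⟨c, hc⟩ := Submodule.Quotient.mk_surjective M ((e.symm.trans r).symm y)
    refine ⟨c, (hT c).trans ?_⟩
    change (e.symm.trans r) (Submodule.Quotient.mk c) = y
    rw [hc, LinearEquiv.apply_symm_apply]

theorem sum_eq_sum_comp_add [Fintype V] [Fintype W] {f : V → W} (hf : Function.Injective f)
    {σ : Finset W} (hσ : ∀ w, w ∈ σ ↔ ∀ v, f v ≠ w) (C : W → R) (x : W → E) :
    ∑ w, C w • x w = ∑ v, C (f v) • x (f v) + ∑ w ∈ σ, C w • x w := by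
  classical
  have h1 : ∑ v, C (f v) • x (f v) = ∑ w ∈ Finset.univ.image f, C w • x w :=
    (Finset.sum_image (f := fun w => C w • x w) fun a _ b _ h => hf h).symm
  have h2 : σ = (Finset.univ.image f)ᶜ := by
    ext w
    simp [hσ]
  rw [h1, h2, Finset.sum_add_sum_compl]

end LinearAlgebra

/-! ### Projections and linear relations -/

section Projections

variable {R : Type} [CommRing R] {V W : Type} [Fintype V] [Fintype W]

/-- A linear map that sends `L (f v)` to `l v` and kills `L w` for `w` outside the range of `f`
exhibits `l` as the projection of `L`; it exists when the relations of `l` are the restrictions of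
those of `L`. -/
theorem exists_linearMap_of_rel_eq {n N : ℕ} {L : W → Fin N → R} {l : V → Fin n → R} {f : V → W}
    (hf : Function.Injective f) (hL : Spans R L)
    (h : rel R l = (rel R L).map (LinearMap.funLeft R R f)) :
    ∃ π : (Fin N → R) →ₗ[R] (Fin n → R), (∀ v, π (L (f v)) = l v) ∧
      ∀ w, (∀ v, f v ≠ w) → π (L w) = 0 := by
  classical
  have hsurj : Function.Surjective (Fintype.linearCombination R L) := fun y => by
    obtain ⟨c, hc⟩ := hL y
    exact ⟨c, by rw [Fintype.linearCombination_apply, hc]⟩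
  let e := LinearMap.quotKerEquivOfSurjective _ hsurj
  let T : (W → R) →ₗ[R] (Fin n → R) := Fintype.linearCombination R l ∘ₗ LinearMap.funLeft R R f
  have hT : LinearMap.ker (Fintype.linearCombination R L) ≤ LinearMap.ker T := by
    intro c hc
    have : LinearMap.funLeft R R f c ∈ rel R l := h ▸ Submodule.mem_map_of_mem hc
    exact this
  let π := (Submodule.liftQ _ T hT) ∘ₗ e.symm.toLinearMap
  have hπ : ∀ w, π (L w) = T (Pi.single w 1) := by
    intro w
    have : L w = e (Submodule.Quotient.mk (Pi.single w 1)) := by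
      have : e (Submodule.Quotient.mk (Pi.single w 1)) =
        Fintype.linearCombination R L (Pi.single w 1) := rfl
      rw [this, Fintype.linearCombination_apply_single, one_smul]
    rw [this]
    simp [π]
  have hT' : ∀ w, T (Pi.single w 1) = ∑ v, (Pi.single w 1 : W → R) (f v) • l v := fun w => by
    simp [T, Fintype.linearCombination_apply, LinearMap.funLeft_apply]
  refine ⟨π, fun v => ?_, fun w hw => ?_⟩
  · rw [hπ, hT', Finset.sum_eq_single v]
    · simp
    · intro u _ hu
      rw [Pi.single_eq_of_ne (fun h => hu (hf h)), zero_smul]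
    · simp
  · rw [hπ, hT']
    exact Finset.sum_eq_zero fun v _ => by rw [Pi.single_eq_of_ne (hw v), zero_smul]

variable {C : CharCat R} {n N : ℕ} {K : Cpx V} {L : W → Fin N → R} {σ : Finset W} {f : V → W}

/-- The relations of a projection are the restrictions of the relations of the configuration. -/
theorem rel_eq_of_hasProj (hf : Function.Injective f) (hσ : ∀ w, w ∈ σ ↔ ∀ v, f v ≠ w)
    {l : CharMap C n K} (h : HasProj L σ f (Quotient.mk (djSetoid C n K) l)) :
    rel R l.1 = (rel R L).map (LinearMap.funLeft R R f) := by
  classical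
  obtain ⟨l', hl', e, he⟩ := h
  obtain ⟨g, hg⟩ := Quotient.exact hl'
  have hrel : rel R l.1 = rel R l'.1 := by
    rw [← rel_equiv_comp l'.1 g]
    exact congrArg (rel R) (funext hg)
  have hsum : ∀ c : V → R, ∑ v, c v • l'.1 v =
      e (Submodule.Quotient.mk (∑ v, c v • L (f v))) := by
    intro c
    rw [← Submodule.mkQ_apply, map_sum, map_sum]
    refine Finset.sum_congr rfl fun v _ => ?_
    rw [map_smul, map_smul, he, Submodule.mkQ_apply]
  rw [hrel]
  ext c
  rw [mem_rel, hsum, map_eq_zero_iff e e.injective, Submodule.Quotient.mk_eq_zero,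
    Submodule.mem_map]
  constructor
  · intro hc
    obtain ⟨d, hd, hds⟩ := (mem_span_image_iff_supported σ L _).1 hc
    refine ⟨fun w => if hw : ∃ v, f v = w then c hw.choose else - d w, ?_, ?_⟩
    · rw [mem_rel, sum_eq_sum_comp_add hf hσ]
      have h1 : ∀ v, (if hw : ∃ u, f u = f v then c hw.choose else - d (f v)) = c v := by
        intro v
        have hv : ∃ u, f u = f v := ⟨v, rfl⟩
        rw [dif_pos hv, hf hv.choose_spec]
      simp only [h1]
      rw [← hds, sum_eq_sum_of_supported hd, ← Finset.sum_add_distrib]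
      refine Finset.sum_eq_zero fun w hw => ?_
      rw [dif_neg (by simpa using (hσ w).1 hw)]
      simp
    · funext v
      have hv : ∃ u, f u = f v := ⟨v, rfl⟩
      rw [LinearMap.funLeft_apply, dif_pos hv, hf hv.choose_spec]
  · rintro ⟨d, hd, rfl⟩
    rw [mem_rel, sum_eq_sum_comp_add hf hσ] at hd
    simp only [LinearMap.funLeft_apply]
    rw [eq_neg_of_add_eq_zero_left hd]
    exact Submodule.neg_mem _ (Submodule.sum_mem _ fun w hw =>
      Submodule.smul_mem _ _ (Submodule.subset_span ⟨w, hw, rfl⟩))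

theorem hasProj_of_rel_eq (hf : Function.Injective f) (hσ : ∀ w, w ∈ σ ↔ ∀ v, f v ≠ w)
    {l : CharMap C n K} (hL : Spans R L) (hl : Spans R l.1)
    (h : rel R l.1 = (rel R L).map (LinearMap.funLeft R R f)) :
    HasProj L σ f (Quotient.mk (djSetoid C n K) l) := by
  obtain ⟨π, hπ, hπ0⟩ := exists_linearMap_of_rel_eq hf hL h
  have hsurj : Function.Surjective π := fun y => by
    obtain ⟨c, hc⟩ := hl y
    refine ⟨∑ v, c v • L (f v), ?_⟩
    rw [map_sum, ← hc]
    exact Finset.sum_congr rfl fun v _ => by rw [map_smul, hπ]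
  have hker : Submodule.span R (L '' (σ : Set W)) = LinearMap.ker π := by
    refine le_antisymm (Submodule.span_le.2 ?_) fun y hy => ?_
    · rintro _ ⟨w, hw, rfl⟩
      exact hπ0 w ((hσ w).1 hw)
    · obtain ⟨c, rfl⟩ := hL y
      have hc : LinearMap.funLeft R R f c ∈ rel R l.1 := by
        rw [mem_rel]
        rw [LinearMap.mem_ker, sum_eq_sum_comp_add hf hσ, map_add, map_sum, map_sum,
          Finset.sum_eq_zero (s := σ) fun w hw => by
            rw [map_smul, hπ0 w ((hσ w).1 hw), smul_zero], add_zero] at hy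
        rw [← hy]
        exact Finset.sum_congr rfl fun v _ => by rw [map_smul, hπ, LinearMap.funLeft_apply]
      rw [h] at hc
      obtain ⟨d, hd, hdc⟩ := hc
      have hdc' : ∀ v, d (f v) = c (f v) := fun v => congrFun hdc v
      rw [SetLike.mem_coe, mem_rel, sum_eq_sum_comp_add hf hσ] at hd
      rw [sum_eq_sum_comp_add hf hσ]
      simp only [← hdc']
      rw [eq_neg_of_add_eq_zero_left hd]
      exact Submodule.add_mem _
        (Submodule.neg_mem _ (Submodule.sum_mem _ fun w hw =>
          Submodule.smul_mem _ _ (Submodule.subset_span ⟨w, hw, rfl⟩)))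
        (Submodule.sum_mem _ fun w hw =>
          Submodule.smul_mem _ _ (Submodule.subset_span ⟨w, hw, rfl⟩))
  refine ⟨l, rfl, (Submodule.quotEquivOfEq _ _ hker).trans
    (LinearMap.quotKerEquivOfSurjective π hsurj), fun v => ?_⟩
  rw [LinearEquiv.trans_apply, Submodule.quotEquivOfEq_mk,
    LinearMap.quotKerEquivOfSurjective_apply_mk, hπ]

end Projections


/-! ### The facets of `K(J)` -/

section MultiWedge

variable {V : Type} {J : V → ℕ} {K : Cpx V}

/-- The embedding `i ↦ i_{α i}` that identifies `K` with the link of `σ(α)` in `K(J)`. -/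
abbrev slot (α : ∀ i, Fin (J i)) : V → (Σ i, Fin (J i)) := fun i => ⟨i, α i⟩

theorem slot_injective (α : ∀ i, Fin (J i)) : Function.Injective (slot α) := fun _ _ h =>
  congrArg Sigma.fst h

theorem exists_isMinNonface_subset {S : Finset V} (hS : S ∉ K) :
    ∃ τ ⊆ S, K.IsMinNonface τ := by
  obtain ⟨τ, hτS, hτ⟩ := exists_minimal_le_of_wellFoundedLT (fun σ => σ ∉ K) S hS
  exact ⟨τ, hτS, hτ.1, fun ρ hρ => by_contra fun h => hρ.not_ge (hτ.2 h hρ.le)⟩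

variable [Fintype V]

theorem mem_complFace_iff_slot {α : ∀ i, Fin (J i)} (w : Σ i, Fin (J i)) :
    w ∈ complFace α ↔ ∀ v, slot α v ≠ w := by
  obtain ⟨i, a⟩ := w
  simp only [complFace, Finset.mem_filter, Finset.mem_univ, true_and]
  constructor
  · rintro h v hv
    obtain rfl : v = i := congrArg Sigma.fst hv
    exact h (eq_of_heq (Sigma.mk.inj hv).2).symm
  · rintro h rfl
    exact h i rfl

variable [DecidableEq V]

/-- The join of `σ(α)` with the copy of `S` in its link: all `i_a` with `i ∈ S` or `a ≠ α i`. -/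
def starFace (S : Finset V) (α : ∀ i, Fin (J i)) : Finset (Σ i, Fin (J i)) :=
  Finset.univ.filter fun x => x.1 ∈ S ∨ x.2 ≠ α x.1

theorem mem_starFace {S : Finset V} {α : ∀ i, Fin (J i)} {x : Σ i, Fin (J i)} :
    x ∈ starFace S α ↔ x.1 ∈ S ∨ x.2 ≠ α x.1 := by
  simp [starFace]

theorem slot_mem_starFace {S : Finset V} {α : ∀ i, Fin (J i)} {i : V} :
    slot α i ∈ starFace S α ↔ i ∈ S := by
  simp [mem_starFace]

theorem eq_slot_of_notMem_starFace {S : Finset V} {α : ∀ i, Fin (J i)} {x : Σ i, Fin (J i)}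
    (h : x ∉ starFace S α) : x.1 ∉ S ∧ x = slot α x.1 := by
  obtain ⟨i, a⟩ := x
  rw [mem_starFace, not_or, not_not] at h
  refine ⟨h.1, ?_⟩
  have := h.2
  simp only at this
  rw [this]

theorem starFace_mem {S : Finset V} (hS : S ∈ K) (α : ∀ i, Fin (J i)) :
    starFace S α ∈ K.multiWedge J := by
  intro τ hτ h
  refine hτ.1 (K.lower (fun i hi => ?_) hS)
  exact slot_mem_starFace.1 (h (Finset.mem_sigma.2 ⟨hi, Finset.mem_univ (α i)⟩))

/-- Every face of `K(J)` lies in the star of some `σ(α)`. -/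
theorem exists_subset_starFace (hJ : ∀ i, 1 ≤ J i) {F : Finset (Σ i, Fin (J i))}
    (hF : F ∈ K.multiWedge J) : ∃ S ∈ K, ∃ α : ∀ i, Fin (J i), F ⊆ starFace S α := by
  let S : Finset V := Finset.univ.filter fun i => ∀ a : Fin (J i), (⟨i, a⟩ : Σ i, Fin (J i)) ∈ F
  have hS : S ∈ K := by
    by_contra h
    obtain ⟨τ, hτS, hτ⟩ := exists_isMinNonface_subset h
    refine hF τ hτ fun x hx => ?_
    exact (Finset.mem_filter.1 (hτS (Finset.mem_sigma.1 hx).1)).2 x.2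
  have hα : ∀ i, ∃ a : Fin (J i), i ∉ S → (⟨i, a⟩ : Σ i, Fin (J i)) ∉ F := by
    intro i
    by_cases hi : i ∈ S
    · exact ⟨⟨0, hJ i⟩, fun h => absurd hi h⟩
    · have := hi
      simp only [S, Finset.mem_filter, Finset.mem_univ, true_and, not_forall] at this
      obtain ⟨a, ha⟩ := this
      exact ⟨a, fun _ => ha⟩
  choose α hα using hα
  refine ⟨S, hS, α, fun x hx => mem_starFace.2 ?_⟩
  by_contra! h
  obtain ⟨i, a⟩ := x
  obtain ⟨h1, h2⟩ := h
  simp only at h1 h2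
  subst h2
  exact hα i h1 hx

theorem card_starFace (hJ : ∀ i, 1 ≤ J i) (S : Finset V) (α : ∀ i, Fin (J i)) :
    (starFace S α).card = S.card + ∑ i, (J i - 1) := by
  have h1 : starFace S α = Finset.univ.sigma fun i =>
      if i ∈ S then Finset.univ else Finset.univ.erase (α i) := by
    ext ⟨i, a⟩
    by_cases hi : i ∈ S <;> simp [mem_starFace, hi]
  rw [h1, Finset.card_sigma]
  have h2 : ∀ i, (if i ∈ S then Finset.univ else Finset.univ.erase (α i)).card =
      (if i ∈ S then 1 else 0) + (J i - 1) := by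
    intro i
    have := hJ i
    by_cases hi : i ∈ S
    · simp only [hi, if_true, Finset.card_univ, Fintype.card_fin]
      omega
    · simp [hi]
  simp only [h2, Finset.sum_add_distrib, Finset.sum_boole, Finset.filter_mem_eq_inter,
    Finset.univ_inter, Nat.cast_id]

/-- The facets of `K(J)` are the joins of the faces `σ(α)` with the facets of `K`. -/
theorem exists_eq_starFace {n : ℕ} (hJ : ∀ i, 1 ≤ J i) (hn : ∀ S ∈ K, S.card ≤ n)
    {F : Finset (Σ i, Fin (J i))} (hF : F ∈ K.multiWedge J)
    (hc : F.card = n + ∑ i, (J i - 1)) :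
    ∃ S ∈ K, S.card = n ∧ ∃ α : ∀ i, Fin (J i), F = starFace S α := by
  obtain ⟨S, hS, α, hFS⟩ := exists_subset_starFace hJ hF
  have h1 := Finset.card_le_card hFS
  rw [card_starFace hJ, hc] at h1
  have h2 := hn S hS
  refine ⟨S, hS, by omega, α, Finset.eq_of_subset_of_card_le hFS ?_⟩
  rw [card_starFace hJ, hc]
  omega

end MultiWedge

/-! ### Restriction of relations to a link -/

section Restriction

variable {R : Type} [CommRing R] {V : Type} {J : V → ℕ}

/-- Restriction of functions on the vertices of `K(J)` to the vertices `i_{α i}`. -/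
abbrev res (R : Type) [CommRing R] {V : Type} {J : V → ℕ} (α : ∀ i, Fin (J i)) :
    ((Σ i, Fin (J i)) → R) →ₗ[R] (V → R) :=
  LinearMap.funLeft R R (slot α)

theorem res_apply (α : ∀ i, Fin (J i)) (c : (Σ i, Fin (J i)) → R) (i : V) :
    res R α c i = c ⟨i, α i⟩ := rfl

variable [Fintype V] [DecidableEq V]

theorem isCobasis_starFace {M : Submodule R ((Σ i, Fin (J i)) → R)} {S : Finset V}
    {α : ∀ i, Fin (J i)} (hM : ∀ c ∈ M, res R α c = 0 → c = 0)
    (h : IsCobasis (M.map (res R α)) S) : IsCobasis M (starFace S α) := by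
  intro u
  obtain ⟨_, ⟨⟨c, hc, rfl⟩, hcu⟩, -⟩ := h (res R α u)
  refine ⟨c, ⟨hc, fun w hw => ?_⟩, fun d hd => ?_⟩
  · obtain ⟨h1, h2⟩ := eq_slot_of_notMem_starFace hw
    rw [h2]
    exact hcu _ h1
  · refine eq_of_sub_eq_zero (hM _ (M.sub_mem hd.1 hc)
      (h.eq_zero ⟨_, M.sub_mem hd.1 hc, rfl⟩ fun i hi => ?_))
    rw [res_apply, Pi.sub_apply, hd.2 _ (fun h => hi (slot_mem_starFace.1 h)), sub_eq_zero]
    exact (hcu i hi).symm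

end Restriction

/-- What the algebra needs to know about `K`: every vertex lies in a face with `n` vertices, and no
face has more. -/
structure HasFacets {V : Type} (n : ℕ) (K : Cpx V) : Prop where
  card_le : ∀ S ∈ K, S.card ≤ n
  exists_mem : ∀ v, ∃ S ∈ K, v ∈ S ∧ S.card = n
  nonempty : ∃ S ∈ K, S.card = n

theorem spans_of_isCharacteristic {R : Type} [CommRing R] {V : Type} [Fintype V] {n : ℕ} {K : Cpx V} (hK : HasFacets n K) {l : V → Fin n → R}
    (hl : IsCharacteristic K l) : Spans R l := by
  obtain ⟨S, hS, hc⟩ := hK.nonempty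
  exact spans_of_span_eq_top (hl S hS hc).2

/-! ### Gluing the relations of a puzzle -/

section Puzzles

variable {R : Type} [CommRing R] {V : Type} [Fintype V] [DecidableEq V]

/-- A category of characteristic maps lifts along the operation `K ↦ K(J)`: a characteristic map
over `K(J)` belongs to the category as soon as all its projections to `K` do. The projections are
described by their linear relations. -/
def Lifts (C : CharCat R) (n : ℕ) (K : Cpx V) : Prop :=
  ∀ (J : V → ℕ), (∀ i, 1 ≤ J i) →
    ∀ L : (Σ i, Fin (J i)) → Fin (n + ∑ i, (J i - 1)) → R,
      IsCharacteristic (K.multiWedge J) L → Spans R L →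
      (∀ α : ∀ i, Fin (J i), ∃ l : V → Fin n → R,
        C V n K l ∧ rel R l = (rel R L).map (res R α)) →
      C _ _ (K.multiWedge J) L

variable {C : CharCat R} {n : ℕ} {K : Cpx V} {J : V → ℕ}

/-- The relations of the class that a puzzle assigns to a vertex of `G(J)`. -/
noncomputable def Puzzle.relAt (p : Puzzle C n K J) (α : ∀ i, Fin (J i)) : Submodule R (V → R) :=
  rel R (p.toFun α).out.1

theorem isCobasis_of_isCharacteristic {W : Type} [Fintype W] {N : ℕ} {L : Cpx W}
    {l : W → Fin N → R} (hl : IsCharacteristic L l) {S : Finset W} (hS : S ∈ L)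
    (hc : S.card = N) : IsCobasis (rel R l) S :=
  isCobasis_rel (hl S hS hc).1 (hl S hS hc).2

theorem res_injOn_rel (hK : HasFacets n K) (hJ : ∀ i, 1 ≤ J i)
    {L : (Σ i, Fin (J i)) → Fin (n + ∑ i, (J i - 1)) → R}
    (hL : IsCharacteristic (K.multiWedge J) L) (α : ∀ i, Fin (J i)) :
    ∀ c ∈ rel R L, res R α c = 0 → c = 0 := by
  intro c hc h0
  obtain ⟨S, hS, hSc⟩ := hK.nonempty
  refine (isCobasis_of_isCharacteristic hL (starFace_mem hS α)
    (by rw [card_starFace hJ, hSc])).eq_zero hc fun w hw => ?_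
  rw [(eq_slot_of_notMem_starFace hw).2]
  exact congrFun h0 _

theorem Puzzle.relAt_eq_of_hasProj {p : Puzzle C n K J}
    {W : Type} [Fintype W] {N : ℕ} {L : W → Fin N → R} {σ : Finset W} {f : V → W}
    (hf : Function.Injective f) (hσ : ∀ w, w ∈ σ ↔ ∀ v, f v ≠ w) {α : ∀ i, Fin (J i)}
    (h : HasProj L σ f (p.toFun α)) :
    p.relAt α = (rel R L).map (LinearMap.funLeft R R f) := by
  rw [← Quotient.out_eq (p.toFun α)] at h
  exact rel_eq_of_hasProj hf hσ h

/-- A puzzle is realized by any module of relations over `K(J)` that restricts isomorphically to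
the relations of each piece of the puzzle. -/
theorem Puzzle.isRealizable_of_relations (hK : HasFacets n K)
    (hC : ∀ l, C V n K l → IsCharacteristic K l) (hlift : Lifts C n K) (hJ : ∀ i, 1 ≤ J i)
    (p : Puzzle C n K J) (M : Submodule R ((Σ i, Fin (J i)) → R))
    (hM : ∀ α, p.relAt α = M.map (res R α))
    (hinj : ∀ α, ∀ c ∈ M, res R α c = 0 → c = 0) : p.IsRealizable := by
  have hcob : ∀ S ∈ K, S.card = n → ∀ α : ∀ i, Fin (J i), IsCobasis M (starFace S α) := by
    intro S hS hSc α
    refine isCobasis_starFace (hinj α) ?_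
    rw [← hM]
    exact isCobasis_of_isCharacteristic (hC _ (p.toFun α).out.2) hS hSc
  obtain ⟨S, hS, hSc⟩ := hK.nonempty
  let α₀ : ∀ i, Fin (J i) := fun i => ⟨0, hJ i⟩
  obtain ⟨L, hLM, hLs⟩ := exists_rel_eq (N := n + ∑ i, (J i - 1))
    (by rw [card_starFace hJ, hSc]) (hcob S hS hSc α₀)
  have hLc : IsCharacteristic (K.multiWedge J) L := by
    intro F hF hFc
    obtain ⟨T, hT, hTc, α, rfl⟩ := exists_eq_starFace hJ hK.card_le hF hFc
    have := hcob T hT hTc α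
    rw [← hLM] at this
    exact ⟨this.linearIndependent, this.span_eq_top hLs⟩
  refine ⟨⟨L, hlift J hJ L hLc hLs fun α => ⟨(p.toFun α).out.1, (p.toFun α).out.2, ?_⟩⟩,
    fun α => ?_⟩
  · rw [hLM]
    exact hM α
  · rw [← Quotient.out_eq (p.toFun α)]
    refine hasProj_of_rel_eq (slot_injective α) mem_complFace_iff_slot hLs
      (spans_of_isCharacteristic hK (hC _ (p.toFun α).out.2)) ?_
    change _ = (rel R L).map (res R α)
    rw [hLM]
    exact hM α

/-- Realizability passes to subpuzzles: restrict the relations. -/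
theorem Puzzle.IsRealizable.sub (hK : HasFacets n K)
    (hC : ∀ l, C V n K l → IsCharacteristic K l)
    (hC' : ∀ L, C _ _ (K.multiWedge J) L →
      IsCharacteristic (n := n + ∑ i, (J i - 1)) (K.multiWedge J) L)
    (hlift : Lifts C n K) (hJ : ∀ i, 1 ≤ J i) {p : Puzzle C n K J} (hp : p.IsRealizable)
    {J' : V → ℕ} (hJ' : ∀ i, 1 ≤ J' i) (φ : ∀ i, Fin (J' i) ↪o Fin (J i)) :
    (Puzzle.sub p φ).IsRealizable := by
  obtain ⟨L, hL⟩ := hp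
  have hrel : ∀ α, p.relAt α = (rel R L.1).map (res R α) := fun α =>
    p.relAt_eq_of_hasProj (slot_injective α) mem_complFace_iff_slot (hL α)
  let ι : (Σ i, Fin (J' i)) → (Σ i, Fin (J i)) := fun x => ⟨x.1, φ x.1 x.2⟩
  have hcomp : ∀ (α : ∀ i, Fin (J' i)) (c : (Σ i, Fin (J i)) → R),
      res R α (LinearMap.funLeft R R ι c) = res R (fun i => φ i (α i)) c := fun _ _ => rfl
  refine isRealizable_of_relations hK hC hlift hJ' _
    ((rel R L.1).map (LinearMap.funLeft R R ι)) (fun α => ?_) ?_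
  · rw [← Submodule.map_comp]
    exact hrel fun i => φ i (α i)
  · rintro α _ ⟨c, hc, rfl⟩ h0
    rw [hcomp] at h0
    rw [res_injOn_rel hK hJ (hC' _ L.2) _ c hc h0, map_zero]

/-- Along an edge of color `v`, every relation of one class extends to a relation of the other one
by changing only its coefficient at `v`. -/
theorem Puzzle.exists_relAt_update (p : Puzzle C n K J) (α : ∀ i, Fin (J i)) (v : V) (b : Fin (J v)) {c : V → R}
    (hc : c ∈ p.relAt α) :
    ∃ d ∈ p.relAt (Function.update α v b), ∀ w, w ≠ v → d w = c w := by
  by_cases hb : α v = b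
  · refine ⟨c, ?_, fun _ _ => rfl⟩
    rwa [← hb, Function.update_eq_self]
  obtain ⟨c₁, c₂, hs, L, h₁, h₂⟩ := p.map_edges s(α, Function.update α v b) v
    ⟨α, Function.update α v b, rfl, by simpa using hb, fun w hw => by
      rw [Function.update_of_ne hw]⟩
  simp only at h₁ h₂ L
  have hf₁ : Function.Injective (fun w => if w = v then none else some w : V → Option V) := by
    intro a b hab
    by_cases ha : a = v <;> by_cases hb : b = v <;> simp_all
  have hσ₁ : ∀ w, w ∈ ({some v} : Finset (Option V)) ↔
      ∀ u, (fun w => if w = v then none else some w : V → Option V) u ≠ w := by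
    intro w
    rw [Finset.mem_singleton]
    constructor
    · rintro rfl u
      by_cases hu : u = v <;> simp [hu]
    · intro h
      cases w with
      | none => exact absurd (h v) (by simp)
      | some u =>
        by_cases hu : u = v
        · rw [hu]
        · exact absurd (h u) (by simp [hu])
  have hf₂ : Function.Injective (fun w => some w : V → Option V) := Option.some_injective V
  have hσ₂ : ∀ w, w ∈ ({none} : Finset (Option V)) ↔
      ∀ u, (fun w => some w : V → Option V) u ≠ w := by
    intro w
    cases w <;> simp
  rcases Sym2.eq_iff.1 hs with ⟨ha, hb'⟩ | ⟨ha, hb'⟩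
  · rw [← ha] at h₁
    rw [← hb'] at h₂
    rw [p.relAt_eq_of_hasProj hf₁ hσ₁ h₁] at hc
    rw [p.relAt_eq_of_hasProj hf₂ hσ₂ h₂]
    obtain ⟨d, hd, rfl⟩ := hc
    refine ⟨_, ⟨d, hd, rfl⟩, fun w hw => ?_⟩
    simp [LinearMap.funLeft_apply, hw]
  · rw [← ha] at h₂
    rw [← hb'] at h₁
    rw [p.relAt_eq_of_hasProj hf₂ hσ₂ h₂] at hc
    rw [p.relAt_eq_of_hasProj hf₁ hσ₁ h₁]
    obtain ⟨d, hd, rfl⟩ := hc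
    refine ⟨_, ⟨d, hd, rfl⟩, fun w hw => ?_⟩
    simp [LinearMap.funLeft_apply, hw]

/-- A relation is determined by its coefficients away from one vertex. -/
theorem Puzzle.relAt_ext (hK : HasFacets n K) (hC : ∀ l, C V n K l → IsCharacteristic K l)
    (p : Puzzle C n K J) {α : ∀ i, Fin (J i)} (v : V) {c d : V → R}
    (hc : c ∈ p.relAt α) (hd : d ∈ p.relAt α) (h : ∀ w, w ≠ v → c w = d w) : c = d := by
  obtain ⟨S, hS, hv, hSc⟩ := hK.exists_mem v
  refine eq_of_sub_eq_zero ((isCobasis_of_isCharacteristic (hC _ (p.toFun α).out.2) hS hSc).eq_zero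
    ((p.relAt α).sub_mem hc hd) fun w hw => ?_)
  rw [Pi.sub_apply, h w (by rintro rfl; exact hw hv), sub_self]

theorem exists_orderEmbedding_of_card {q r : ℕ} (a b : Fin q)
    (h : (r = 1 ∧ a = b) ∨ (r = 2 ∧ a ≠ b)) :
    ∃ (φ : Fin r ↪o Fin q) (u u' : Fin r), φ u = a ∧ φ u' = b := by
  rcases h with ⟨rfl, rfl⟩ | ⟨rfl, hab⟩
  · exact ⟨OrderEmbedding.ofStrictMono (fun _ => a) (Subsingleton.strictMono _), 0, 0, rfl, rfl⟩
  · wlog hlt : a < b generalizing a b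
    · obtain ⟨φ, u, u', h, h'⟩ := this b a hab.symm (lt_of_le_of_ne (not_lt.1 hlt) hab.symm)
      exact ⟨φ, u', u, h', h⟩
    · refine ⟨OrderEmbedding.ofStrictMono ![a, b] ?_, 0, 1, rfl, rfl⟩
      rw [Fin.strictMono_iff_lt_succ]
      intro i
      fin_cases i
      simpa using hlt

/-- In a realizable square, every relation at a corner extends to the two adjacent corners, and the
values found there glue to a relation at the opposite corner. -/
theorem Puzzle.exists_relAt_square (p : Puzzle C n K J)
    (hp : p.SubsquaresRealizable) (α : ∀ i, Fin (J i)) {j k : V} (hjk : j ≠ k)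
    {x : Fin (J j)} {y : Fin (J k)} (hx : α j ≠ x) (hy : α k ≠ y) {c : V → R}
    (hc : c ∈ p.relAt α) :
    ∃ d : V → R, (∀ i, i ≠ j → i ≠ k → d i = c i) ∧
      Function.update c j (d j) ∈ p.relAt (Function.update α j x) ∧
      Function.update c k (d k) ∈ p.relAt (Function.update α k y) ∧
      d ∈ p.relAt (Function.update (Function.update α j x) k y) := by
  let J' : V → ℕ := fun i => if i = j ∨ i = k then 2 else 1
  let β := Function.update (Function.update α j x) k y
  have hβ : ∀ i, (J' i = 1 ∧ α i = β i) ∨ (J' i = 2 ∧ α i ≠ β i) := by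
    intro i
    by_cases hij : i = j
    · subst hij
      exact Or.inr ⟨by simp [J'], by simpa [β, Function.update_of_ne hjk] using hx⟩
    · by_cases hik : i = k
      · subst hik
        exact Or.inr ⟨by simp [J'], by simpa [β] using hy⟩
      · exact Or.inl ⟨by simp [J', hij, hik], by
          simp [β, Function.update_of_ne hij, Function.update_of_ne hik]⟩
  choose φ u u' hu hu' using fun i => exists_orderEmbedding_of_card (α i) (β i) (hβ i)
  have hJ' : IsHypercube 2 J' := by
    refine ⟨fun i => (hβ i).imp And.left And.left, ?_⟩
    refine Eq.trans (congrArg Finset.card (Finset.ext fun i => ?_)) (Finset.card_pair hjk)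
    simp only [J', Finset.mem_filter, Finset.mem_univ, true_and, Finset.mem_insert,
      Finset.mem_singleton]
    split_ifs with h <;> simp [h]
  obtain ⟨L, hL⟩ := hp J' hJ' φ
  have hrel : ∀ γ : ∀ i, Fin (J' i), ∀ γ' : ∀ i, Fin (J i), (∀ i, φ i (γ i) = γ' i) →
      p.relAt γ' = (rel R L.1).map (res R γ) := fun γ γ' hγ => by
    obtain rfl : (fun i => φ i (γ i)) = γ' := funext hγ
    exact (Puzzle.sub p φ).relAt_eq_of_hasProj (slot_injective γ) mem_complFace_iff_slot (hL γ)
  rw [hrel u α hu] at hc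
  obtain ⟨d, hd, rfl⟩ := hc
  have hoff : ∀ i, i ≠ j → i ≠ k → u' i = u i := fun i hij hik => (φ i).injective (by
    rw [hu, hu']
    simp [β, Function.update_of_ne hij, Function.update_of_ne hik])
  refine ⟨res R u' d, fun i hij hik => ?_, ?_, ?_, ?_⟩
  · rw [res_apply, res_apply, hoff i hij hik]
  · rw [hrel (Function.update u j (u' j)) _ fun i => ?_]
    · refine ⟨d, hd, funext fun i => ?_⟩
      by_cases hij : i = j
      · subst hij
        rw [Function.update_self, res_apply, res_apply, Function.update_self]
      · rw [Function.update_of_ne hij, res_apply, res_apply, Function.update_of_ne hij]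
    · by_cases hij : i = j
      · subst hij
        simp [hu', β, Function.update_of_ne hjk]
      · simp [Function.update_of_ne hij, hu]
  · rw [hrel (Function.update u k (u' k)) _ fun i => ?_]
    · refine ⟨d, hd, funext fun i => ?_⟩
      by_cases hik : i = k
      · subst hik
        rw [Function.update_self, res_apply, res_apply, Function.update_self]
      · rw [Function.update_of_ne hik, res_apply, res_apply, Function.update_of_ne hik]
    · by_cases hik : i = k
      · subst hik
        simp [hu', β]
      · simp [Function.update_of_ne hik, hu]
  · rw [hrel u' _ hu']
    exact ⟨d, hd, rfl⟩

/-- If all subsquares are realizable, every relation at one vertex of `G(J)` extends to a function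
on the vertices of `K(J)` whose restrictions are relations at all vertices of `G(J)`. The values are
read off from the neighbors of the given vertex, and the squares propagate the property. -/
theorem Puzzle.exists_global_relation (hK : HasFacets n K)
    (hC : ∀ l, C V n K l → IsCharacteristic K l)
    (p : Puzzle C n K J) (hp : p.SubsquaresRealizable) (α₀ : ∀ i, Fin (J i)) {a : V → R}
    (ha : a ∈ p.relAt α₀) :
    ∃ c : (Σ i, Fin (J i)) → R, res R α₀ c = a ∧ ∀ α, res R α c ∈ p.relAt α := by
  choose d hd hda using fun (v : V) (b : Fin (J v)) =>
    p.exists_relAt_update α₀ v b ha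
  let c : (Σ i, Fin (J i)) → R := fun x => d x.1 x.2 x.1
  have hc₀ : res R α₀ c = a := by
    funext i
    have : d i (α₀ i) = a := p.relAt_ext hK hC i
      (by simpa using hd i (α₀ i)) ha (hda i (α₀ i))
    exact congrFun this i
  refine ⟨c, hc₀, ?_⟩
  -- induction on the number of coordinates in which `α` differs from `α₀`
  suffices h : ∀ (r : ℕ) (α : ∀ i, Fin (J i)),
      (Finset.univ.filter fun i => α i ≠ α₀ i).card = r → res R α c ∈ p.relAt α from
    fun α => h _ α rfl
  intro r
  induction r using Nat.strong_induction_on with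
  | _ r ih =>
    intro α hr
    by_cases h0 : ∀ i, α i = α₀ i
    · rw [funext h0, hc₀]
      exact ha
    push Not at h0
    obtain ⟨j, hj⟩ := h0
    by_cases h1 : ∀ i, i ≠ j → α i = α₀ i
    · have hα : α = Function.update α₀ j (α j) := by
        funext i
        by_cases hij : i = j
        · subst hij
          simp
        · rw [Function.update_of_ne hij, h1 i hij]
      have : res R α c = d j (α j) := by
        funext i
        by_cases hij : i = j
        · subst hij
          rfl
        · rw [hda j _ i hij, res_apply, h1 i hij]
          exact congrFun hc₀ i
      rw [this]
      have h := hd j (α j)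
      rwa [← hα] at h
    push Not at h1
    obtain ⟨k, hkj, hk⟩ := h1
    have hlt : ∀ β : ∀ i, Fin (J i), ∀ i₀, α i₀ ≠ α₀ i₀ → β i₀ = α₀ i₀ →
        (∀ i, β i = α i ∨ β i = α₀ i) → res R β c ∈ p.relAt β := by
      intro β i₀ h1 h2 h3
      refine ih _ ?_ β rfl
      rw [← hr]
      refine Finset.card_lt_card ((Finset.ssubset_iff_of_subset fun i => ?_).2 ⟨i₀, ?_, ?_⟩)
      · simp only [Finset.mem_filter, Finset.mem_univ, true_and]
        intro hi
        rcases h3 i with h | h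
        · rwa [← h]
        · exact absurd h hi
      · simpa using h1
      · simpa using h2
    let δ := Function.update (Function.update α j (α₀ j)) k (α₀ k)
    have hδj : δ j = α₀ j := by simp [δ, Function.update_of_ne hkj.symm]
    have hδk : δ k = α₀ k := by simp [δ]
    have hδ : ∀ i, i ≠ j → i ≠ k → δ i = α i := fun i hij hik => by
      simp [δ, Function.update_of_ne hij, Function.update_of_ne hik]
    have hδ' : ∀ i, δ i = α i ∨ δ i = α₀ i := by
      intro i
      by_cases hij : i = j
      · subst hij
        exact Or.inr hδj
      · by_cases hik : i = k
        · subst hik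
          exact Or.inr hδk
        · exact Or.inl (hδ i hij hik)
    have hup : ∀ i b, res R (Function.update δ i b) c =
        Function.update (res R δ c) i (c ⟨i, b⟩) := by
      intro i b
      funext l
      by_cases hl : l = i
      · subst hl
        rw [Function.update_self, res_apply, Function.update_self]
      · rw [Function.update_of_ne hl, res_apply, res_apply, Function.update_of_ne hl]
    have hupα : ∀ i b, b = α i → ∀ l, Function.update δ i b l = α l ∨
        Function.update δ i b l = α₀ l := by
      rintro i b rfl l
      by_cases hl : l = i
      · subst hl
        simp
      · rw [Function.update_of_ne hl]
        exact hδ' l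
    obtain ⟨e, he, hej, hek, hejk⟩ := p.exists_relAt_square hp δ hkj.symm
      (x := α j) (y := α k) (by rw [hδj]; exact hj.symm) (by rw [hδk]; exact hk.symm)
      (hlt δ j hj hδj hδ')
    have hβ := hlt (Function.update δ j (α j)) k hk
      (by rw [Function.update_of_ne hkj, hδk]) (hupα j _ rfl)
    have hγ := hlt (Function.update δ k (α k)) j hj
      (by rw [Function.update_of_ne hkj.symm, hδj]) (hupα k _ rfl)
    rw [hup] at hβ hγ
    have h1 := congrFun (p.relAt_ext hK hC j hβ hej fun w hw => by
      rw [Function.update_of_ne hw, Function.update_of_ne hw]) j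
    have h2 := congrFun (p.relAt_ext hK hC k hγ hek fun w hw => by
      rw [Function.update_of_ne hw, Function.update_of_ne hw]) k
    rw [Function.update_self, Function.update_self] at h1 h2
    have hα : Function.update (Function.update δ j (α j)) k (α k) = α := by
      funext i
      by_cases hik : i = k
      · subst hik
        simp
      · rw [Function.update_of_ne hik]
        by_cases hij : i = j
        · subst hij
          simp
        · rw [Function.update_of_ne hij, hδ i hij hik]
    rw [hα] at hejk
    have : res R α c = e := by
      funext i
      by_cases hij : i = j
      · subst hij
        exact h1
      · by_cases hik : i = k
        · subst hik
          exact h2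
        · rw [he i hij hik, res_apply, res_apply, hδ i hij hik]
    rw [this]
    exact hejk

/-- The criterion for all categories that lift to `K(J)`. -/
theorem Puzzle.isRealizable_iff (hK : HasFacets n K)
    (hC : ∀ (W : Type) (N : ℕ) (L : Cpx W) l, C W N L l → IsCharacteristic L l)
    (hlift : Lifts C n K) (hJ : ∀ i, 1 ≤ J i) (p : Puzzle C n K J) :
    p.IsRealizable ↔ p.SubsquaresRealizable := by
  constructor
  · intro h J' hJ' φ
    exact h.sub hK (hC _ _ _) (hC _ _ _) hlift hJ
      (fun i => by rcases hJ'.1 i with h | h <;> omega) φ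
  · intro h
    refine p.isRealizable_of_relations hK (hC _ _ _) hlift hJ
      (⨅ α, (p.relAt α).comap (res R α)) (fun α => le_antisymm (fun a ha => ?_) ?_) ?_
    · obtain ⟨c, hc, hcα⟩ := p.exists_global_relation hK (hC _ _ _) h α ha
      exact ⟨c, (Submodule.mem_iInf _).2 hcα, hc⟩
    · rintro _ ⟨c, hc, rfl⟩
      exact (Submodule.mem_iInf _).1 hc α
    · intro α c hc h0
      have hc' : ∀ α, res R α c ∈ p.relAt α := (Submodule.mem_iInf _).1 hc
      funext ⟨i, b⟩
      have := p.relAt_ext hK (hC _ _ _) i (hc' (Function.update α i b)) (Submodule.zero_mem _)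
        fun w hw => by
          have := congrFun h0 w
          rw [res_apply] at this ⊢
          rwa [Function.update_of_ne hw]
      have := congrFun this i
      rw [res_apply, Function.update_self] at this
      exact this

end Puzzles


/-! ### Coordinates with respect to the vectors on a face -/

section Coordinates

variable {W : Type} {n : ℕ}

/-- The vectors `x v`, `v ∈ F`, form a basis. -/
structure IsBasisOn (x : W → Fin n → ℝ) (F : Finset W) : Prop where
  indep : LinearIndependent ℝ (fun v : F => x v)
  card : F.card = n

theorem IsBasisOn.span_eq_top {x : W → Fin n → ℝ} {F : Finset W} (h : IsBasisOn x F) :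
    Submodule.span ℝ (x '' (F : Set W)) = ⊤ := by
  have := h.indep.span_eq_top_of_card_eq_finrank' (by simp [h.card])
  rwa [show Set.range (fun v : F => x v) = x '' (F : Set W) by
    rw [Set.image_eq_range]; rfl] at this

variable [Fintype W]

theorem exists_coord {x : W → Fin n → ℝ} {F : Finset W}
    (hF : LinearIndependent ℝ (fun v : F => x v)) :
    ∃ κ : (Fin n → ℝ) →ₗ[ℝ] (W → ℝ), (∀ y w, w ∉ F → κ y w = 0) ∧
      ∀ a : W → ℝ, (∀ w, w ∉ F → a w = 0) → κ (∑ w, a w • x w) = a := by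
  rw [linearIndependent_iff_supported] at hF
  let S : Submodule ℝ (W → ℝ) :=
    { carrier := {a | ∀ w, w ∉ F → a w = 0}
      add_mem' := fun {a b} ha hb w hw => by simp [ha w hw, hb w hw]
      zero_mem' := fun _ _ => rfl
      smul_mem' := fun r a ha w hw => by simp [ha w hw] }
  obtain ⟨g, hg⟩ := LinearMap.exists_leftInverse_of_injective
    (Fintype.linearCombination ℝ x ∘ₗ S.subtype) (by
      rw [LinearMap.ker_eq_bot']
      intro a ha
      exact Subtype.ext (hF a a.2 (by simpa [Fintype.linearCombination_apply] using ha)))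
  refine ⟨S.subtype ∘ₗ g, fun y w hw => (g y).2 w hw, fun a ha => ?_⟩
  have := LinearMap.congr_fun hg ⟨a, ha⟩
  simp only [LinearMap.comp_apply, Submodule.subtype_apply, Fintype.linearCombination_apply,
    LinearMap.id_apply] at this
  rw [LinearMap.comp_apply, this]
  rfl

open Classical in
/-- The coordinates of a vector with respect to the independent vectors `x v`, `v ∈ F`, extended by
zero outside `F`. On vectors outside the span of `x '' F` this is an arbitrary linear extension, and
it is zero if the vectors are dependent. -/
noncomputable def coord (x : W → Fin n → ℝ) (F : Finset W) : (Fin n → ℝ) →ₗ[ℝ] (W → ℝ) :=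
  if h : LinearIndependent ℝ (fun v : F => x v) then (exists_coord h).choose else 0

variable {x : W → Fin n → ℝ} {F G : Finset W}

theorem coord_of_notMem (y : Fin n → ℝ) {w : W} (hw : w ∉ F) : coord x F y w = 0 := by
  unfold coord
  split_ifs with h
  · exact (exists_coord h).choose_spec.1 y w hw
  · rfl

theorem coord_sum (hF : LinearIndependent ℝ (fun v : F => x v)) {a : W → ℝ}
    (ha : ∀ w, w ∉ F → a w = 0) : coord x F (∑ w, a w • x w) = a := by
  unfold coord
  rw [dif_pos hF]
  exact (exists_coord hF).choose_spec.2 a ha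

theorem coord_self [DecidableEq W] (hF : LinearIndependent ℝ (fun v : F => x v)) {v : W}
    (hv : v ∈ F) : coord x F (x v) = Pi.single v 1 := by
  have := coord_sum hF (a := Pi.single v 1) fun w hw =>
    Pi.single_eq_of_ne (by rintro rfl; exact hw hv) 1
  rw [← this]
  congr 1
  rw [Finset.sum_eq_single v (fun w _ hw => by rw [Pi.single_eq_of_ne hw, zero_smul]) (by simp)]
  simp

theorem sum_coord_of_mem_span (hF : LinearIndependent ℝ (fun v : F => x v)) {y : Fin n → ℝ}
    (hy : y ∈ Submodule.span ℝ (x '' (F : Set W))) : ∑ w, coord x F y w • x w = y := by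
  obtain ⟨a, ha, rfl⟩ := (mem_span_image_iff_supported F x y).1 hy
  rw [coord_sum hF ha]

theorem IsBasisOn.sum_coord (h : IsBasisOn x F) (y : Fin n → ℝ) :
    ∑ w, coord x F y w • x w = y :=
  sum_coord_of_mem_span h.indep (h.span_eq_top ▸ Submodule.mem_top)

/-- Change of basis. -/
theorem IsBasisOn.coord_eq_sum (hG : IsBasisOn x G) (F : Finset W) (y : Fin n → ℝ) (v : W) :
    coord x F y v = ∑ u, coord x G y u * coord x F (x u) v := by
  conv_lhs => rw [← hG.sum_coord y, map_sum]
  simp [Finset.sum_apply]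

variable [DecidableEq W]

theorem coord_exchange (hF : IsBasisOn x F) {w w' : W} (hw' : w' ∉ F)
    (hG : IsBasisOn x (insert w' (F.erase w))) (y : Fin n → ℝ) (v : W) :
    coord x F y v = (if v ∈ F.erase w then coord x (insert w' (F.erase w)) y v else 0) +
      coord x (insert w' (F.erase w)) y w' * coord x F (x w') v := by
  have hw'' : w' ∉ F.erase w := fun h => hw' (Finset.mem_of_mem_erase h)
  rw [hG.coord_eq_sum F y v, ← Finset.sum_subset (Finset.subset_univ (insert w' (F.erase w)))
    fun u _ hu => by rw [coord_of_notMem _ hu, zero_mul], Finset.sum_insert hw'', add_comm]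
  congr 1
  have : ∀ u ∈ F.erase w, coord x (insert w' (F.erase w)) y u * coord x F (x u) v =
      if u = v then coord x (insert w' (F.erase w)) y u else 0 := fun u hu => by
    rw [coord_self hF.indep (Finset.mem_of_mem_erase hu), Pi.single_apply]
    by_cases h : u = v
    · simp [h]
    · simp [h, Ne.symm h]
  rw [Finset.sum_congr rfl this, Finset.sum_ite_eq']

theorem coord_exchange_self (hF : IsBasisOn x F) {w w' : W} (hw' : w' ∉ F)
    (hG : IsBasisOn x (insert w' (F.erase w))) (y : Fin n → ℝ) :
    coord x F y w = coord x (insert w' (F.erase w)) y w' * coord x F (x w') w := by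
  rw [coord_exchange hF hw' hG, if_neg (Finset.notMem_erase w F), zero_add]

theorem coord_exchange_ne_zero (hF : IsBasisOn x F) {w w' : W} (hw : w ∈ F) (hw' : w' ∉ F)
    (hG : IsBasisOn x (insert w' (F.erase w))) : coord x F (x w') w ≠ 0 := by
  intro h
  have := coord_exchange_self hF hw' hG (x w)
  rw [h, mul_zero, coord_self hF.indep hw, Pi.single_eq_same] at this
  exact one_ne_zero this

end Coordinates

/-! ### Generic vectors -/

section Generic

open MeasureTheory

variable {n : ℕ}

theorem ae_ne_zero {f : (Fin n → ℝ) →ₗ[ℝ] ℝ} (hf : f ≠ 0) :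
    ∀ᵐ z : Fin n → ℝ, f z ≠ 0 := by
  have h := Measure.addHaar_submodule (volume : Measure (Fin n → ℝ)) (LinearMap.ker f)
    (fun h => hf (LinearMap.ker_eq_top.1 h))
  rw [ae_iff]
  simp only [not_not]
  exact h

theorem exists_mem_of_ae {p : (Fin n → ℝ) → Prop} (hp : ∀ᵐ z, p z) {U : Set (Fin n → ℝ)}
    (hU : IsOpen U) (hne : U.Nonempty) : ∃ z ∈ U, p z := by
  obtain ⟨z, hz, hzU⟩ := (Measure.dense_of_ae hp).exists_mem_open hU hne
  exact ⟨z, hzU, hz⟩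

end Generic

/-! ### The number of cones that cover a generic vector -/

section Count

open MeasureTheory Filter Topology

variable {W : Type} [Fintype W] [DecidableEq W] {n : ℕ}

/-- A finite family of bases containing `A`, any of whose elements `w ∉ A` can be exchanged in
exactly one way, and then the new vector lies on the other side of the wall spanned by the remaining
vectors. -/
structure IsCrossing (x : W → Fin n → ℝ) (A : Finset W) (𝓕 : Finset (Finset W)) : Prop where
  basis : ∀ F ∈ 𝓕, IsBasisOn x F
  subset : ∀ F ∈ 𝓕, A ⊆ F
  exchange : ∀ F ∈ 𝓕, ∀ w ∈ F, w ∉ A → ∃ w', w' ∉ F ∧ insert w' (F.erase w) ∈ 𝓕 ∧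
    coord x F (x w') w < 0 ∧ ∀ w'', w'' ∉ F → insert w'' (F.erase w) ∈ 𝓕 → w'' = w'

/-- The vector `y` lies in the interior of `cone (x '' F) + span (x '' A)`. -/
def Inside (x : W → Fin n → ℝ) (A F : Finset W) (y : Fin n → ℝ) : Prop :=
  ∀ w ∈ F, w ∉ A → 0 < coord x F y w

/-- The vector `y` lies on none of the walls of the family. -/
def IsGeneric (x : W → Fin n → ℝ) (A : Finset W) (𝓕 : Finset (Finset W)) (y : Fin n → ℝ) : Prop :=
  ∀ F ∈ 𝓕, ∀ w ∈ F, w ∉ A → coord x F y w ≠ 0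

/-- The points `z + ε u` for small `ε > 0` lie in the interior of `cone (x '' F) + span (x '' A)`. -/
def InsideGerm (x : W → Fin n → ℝ) (A F : Finset W) (z u : Fin n → ℝ) : Prop :=
  ∀ w ∈ F, w ∉ A → 0 < coord x F z w ∨ (coord x F z w = 0 ∧ 0 < coord x F u w)

variable {x : W → Fin n → ℝ} {A : Finset W} {𝓕 : Finset (Finset W)}

open Classical in
/-- The number of cones of the family that cover `y`. -/
noncomputable def coverCount (x : W → Fin n → ℝ) (A : Finset W) (𝓕 : Finset (Finset W))
    (y : Fin n → ℝ) : ℕ :=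
  (𝓕.filter fun F => Inside x A F y).card

open Classical in
theorem IsCrossing.card_germ_le (h : IsCrossing x A 𝓕) {z u : Fin n → ℝ}
    (hz : ∀ F ∈ 𝓕, ∀ w ∈ F, w ∉ A → ∀ v ∈ F, v ∉ A → coord x F z w = 0 → coord x F z v = 0 →
      w = v) :
    (𝓕.filter fun F => InsideGerm x A F z u).card ≤
      (𝓕.filter fun F => InsideGerm x A F z (-u)).card := by
  -- a cone whose wall contains `z` is matched with the cone on the other side of that wall
  refine Finset.card_le_card_of_forall_subsingleton
    (fun F G => (F = G ∧ ∀ w ∈ G, w ∉ A → coord x G z w ≠ 0) ∨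
      ∃ w ∈ F, w ∉ A ∧ coord x F z w = 0 ∧ ∃ w', w' ∉ F ∧ G = insert w' (F.erase w)) ?_ ?_
  · intro F hF
    obtain ⟨hF, hg⟩ := Finset.mem_filter.1 hF
    by_cases h0 : ∃ w ∈ F, w ∉ A ∧ coord x F z w = 0
    · obtain ⟨w, hw, hwA, hw0⟩ := h0
      obtain ⟨w', hw', hG, hneg, -⟩ := h.exchange F hF w hw hwA
      refine ⟨_, Finset.mem_filter.2 ⟨hG, ?_⟩, Or.inr ⟨w, hw, hwA, hw0, w', hw', rfl⟩⟩
      have hFb := h.basis F hF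
      have hGb := h.basis _ hG
      have hz0 : coord x (insert w' (F.erase w)) z w' = 0 := by
        have := coord_exchange_self hFb hw' hGb z
        rw [hw0] at this
        exact (mul_eq_zero.1 this.symm).resolve_right hneg.ne
      intro v hv hvA
      rw [Finset.mem_insert] at hv
      rcases hv with rfl | hv
      · refine Or.inr ⟨hz0, ?_⟩
        have hu : 0 < coord x F u w := by
          rcases hg w hw hwA with h' | h'
          · exact absurd hw0 h'.ne'
          · exact h'.2
        rw [coord_exchange_self hFb hw' hGb u] at hu
        rw [map_neg, Pi.neg_apply, neg_pos]
        by_contra! hle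
        exact absurd hu (not_lt.2 (mul_nonpos_of_nonneg_of_nonpos hle hneg.le))
      · left
        have hvF := Finset.mem_of_mem_erase hv
        have := coord_exchange hFb hw' hGb z v
        rw [if_pos hv, hz0, zero_mul, add_zero] at this
        rw [← this]
        rcases hg v hvF hvA with h' | h'
        · exact h'
        · exact absurd (hz F hF v hvF hvA w hw hwA h'.1 hw0) (Finset.ne_of_mem_erase hv)
    · push Not at h0
      refine ⟨F, Finset.mem_filter.2 ⟨hF, fun w hw hwA => ?_⟩, Or.inl ⟨rfl, h0⟩⟩
      exact Or.inl ((hg w hw hwA).resolve_right fun h' => h0 w hw hwA h'.1)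
  · intro G hG F₁ hF₁ F₂ hF₂
    have hG' := (Finset.mem_filter.1 hG).1
    have key : ∀ F ∈ 𝓕, ∀ w ∈ F, w ∉ A → coord x F z w = 0 → ∀ w', w' ∉ F →
        G = insert w' (F.erase w) → w' ∈ G ∧ w' ∉ A ∧ coord x G z w' = 0 ∧ w ∉ G ∧
          F = insert w (G.erase w') := by
      rintro F hF w hw hwA hw0 w' hw' rfl
      have hne : w ≠ w' := by
        rintro rfl
        exact hw' hw
      refine ⟨Finset.mem_insert_self _ _, fun h' => hw' (h.subset F hF h'), ?_, ?_, ?_⟩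
      · have := coord_exchange_self (h.basis F hF) hw' (h.basis _ hG') z
        rw [hw0] at this
        exact (mul_eq_zero.1 this.symm).resolve_right
          (coord_exchange_ne_zero (h.basis F hF) hw hw' (h.basis _ hG'))
      · simp [hne]
      · rw [Finset.erase_insert (fun h' => hw' (Finset.mem_of_mem_erase h')),
          Finset.insert_erase hw]
    have hm₁ := (Finset.mem_filter.1 hF₁.1).1
    have hm₂ := (Finset.mem_filter.1 hF₂.1).1
    rcases hF₁.2 with ⟨rfl, hn₁⟩ | ⟨w₁, hw₁, hA₁, h0₁, w₁', hw₁', hG₁⟩ <;>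
      rcases hF₂.2 with ⟨rfl, hn₂⟩ | ⟨w₂, hw₂, hA₂, h0₂, w₂', hw₂', hG₂⟩
    · rfl
    · obtain ⟨k1, k2, k3, -⟩ := key _ hm₂ _ hw₂ hA₂ h0₂ _ hw₂' hG₂
      exact absurd k3 (hn₁ _ k1 k2)
    · obtain ⟨k1, k2, k3, -⟩ := key _ hm₁ _ hw₁ hA₁ h0₁ _ hw₁' hG₁
      exact absurd k3 (hn₂ _ k1 k2)
    · obtain ⟨k1, k2, k3, k4, k5⟩ := key _ hm₁ _ hw₁ hA₁ h0₁ _ hw₁' hG₁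
      obtain ⟨l1, l2, l3, l4, l5⟩ := key _ hm₂ _ hw₂ hA₂ h0₂ _ hw₂' hG₂
      obtain rfl := hz _ hG' _ k1 k2 _ l1 l2 k3 l3
      obtain ⟨v, -, -, -, hv⟩ := h.exchange _ hG' _ k1 k2
      rw [k5] at hm₁
      rw [l5] at hm₂
      rw [k5, l5, hv _ k4 hm₁, hv _ l4 hm₂]

theorem eventually_right_germ (p q t : ℝ) :
    ∀ᶠ s in 𝓝[>] t, (0 < p + s * q ∨ (p + s * q = 0 ∧ 0 < q)) ↔
      (0 < p + t * q ∨ (p + t * q = 0 ∧ 0 < q)) := by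
  have hc : Tendsto (fun s : ℝ => p + s * q) (𝓝[>] t) (𝓝 (p + t * q)) :=
    ((continuous_const.add (continuous_id.mul continuous_const)).tendsto t).mono_left
      nhdsWithin_le_nhds
  rcases lt_trichotomy (p + t * q) 0 with h | h | h
  · filter_upwards [hc.eventually_lt_const h] with s hs
    constructor
    · rintro (h' | ⟨h', -⟩) <;> exfalso <;> linarith
    · rintro (h' | ⟨h', -⟩) <;> exfalso <;> linarith
  · filter_upwards [self_mem_nhdsWithin] with s hs
    have hs' : 0 < s - t := sub_pos.2 hs
    have he : p + s * q = (s - t) * q := by linear_combination h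
    rw [he, h]
    constructor
    · rintro (h' | h')
      · exact Or.inr ⟨rfl, (pos_iff_pos_of_mul_pos h').1 hs'⟩
      · exact Or.inr ⟨rfl, h'.2⟩
    · rintro (h' | h')
      · exact absurd h' (lt_irrefl _)
      · exact Or.inl (mul_pos hs' h'.2)
  · filter_upwards [hc.eventually_const_lt h] with s hs
    exact ⟨fun _ => Or.inl h, fun _ => Or.inl hs⟩

theorem eventually_left_germ {p q t : ℝ} (hpq : p + t * q = 0 → q ≠ 0) :
    ∀ᶠ s in 𝓝[<] t, (0 < p + s * q ∨ (p + s * q = 0 ∧ 0 < q)) ↔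
      (0 < p + t * q ∨ (p + t * q = 0 ∧ 0 < -q)) := by
  have hc : Tendsto (fun s : ℝ => p + s * q) (𝓝[<] t) (𝓝 (p + t * q)) :=
    ((continuous_const.add (continuous_id.mul continuous_const)).tendsto t).mono_left
      nhdsWithin_le_nhds
  rcases lt_trichotomy (p + t * q) 0 with h | h | h
  · filter_upwards [hc.eventually_lt_const h] with s hs
    constructor
    · rintro (h' | ⟨h', -⟩) <;> exfalso <;> linarith
    · rintro (h' | ⟨h', -⟩) <;> exfalso <;> linarith
  · filter_upwards [self_mem_nhdsWithin] with s hs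
    have hs' : 0 < t - s := sub_pos.2 hs
    have he : p + s * q = (t - s) * -q := by linear_combination h
    rw [he, h]
    constructor
    · rintro (h' | h')
      · exact Or.inr ⟨rfl, (pos_iff_pos_of_mul_pos h').1 hs'⟩
      · exact absurd h'.1 (mul_ne_zero hs'.ne' (neg_ne_zero.2 (hpq h)))
    · rintro (h' | h')
      · exact absurd h' (lt_irrefl _)
      · exact Or.inl (mul_pos hs' h'.2)
  · filter_upwards [hc.eventually_const_lt h] with s hs
    exact ⟨fun _ => Or.inl h, fun _ => Or.inl hs⟩

/-- On a line that meets the walls of each cone one at a time, the number of covering cones does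
not change. -/
theorem IsCrossing.coverCount_eq_of_line (h : IsCrossing x A 𝓕) {y z : Fin n → ℝ}
    (hy : IsGeneric x A 𝓕 y) (hz : IsGeneric x A 𝓕 z)
    (hyz : ∀ F ∈ 𝓕, ∀ w ∈ F, w ∉ A → ∀ v ∈ F, v ∉ A → w ≠ v →
      coord x F y w * coord x F z v ≠ coord x F y v * coord x F z w) :
    coverCount x A 𝓕 y = coverCount x A 𝓕 z := by
  classical
  have hlin : ∀ F (t : ℝ) w, coord x F (y + t • (z - y)) w =
      coord x F y w + t * coord x F (z - y) w := fun F t w => by simp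
  have hu : ∀ F w, coord x F (z - y) w = coord x F z w - coord x F y w := fun F w => by simp
  have hone : ∀ t : ℝ, ∀ F ∈ 𝓕, ∀ w ∈ F, w ∉ A → ∀ v ∈ F, v ∉ A →
      coord x F (y + t • (z - y)) w = 0 → coord x F (y + t • (z - y)) v = 0 → w = v := by
    intro t F hF w hw hwA v hv hvA h1 h2
    by_contra hne
    rw [hlin, hu] at h1 h2
    have hd := hyz F hF w hw hwA v hv hvA hne
    have ht : t = 0 := by
      by_contra ht
      refine hd (mul_left_cancel₀ ht ?_)
      linear_combination coord x F y w * h2 - coord x F y v * h1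
    rw [ht] at h1
    exact hy F hF w hw hwA (by linarith)
  have hslope : ∀ t : ℝ, ∀ F ∈ 𝓕, ∀ w ∈ F, w ∉ A →
      coord x F y w + t * coord x F (z - y) w = 0 → coord x F (z - y) w ≠ 0 := by
    intro t F hF w hw hwA h1 h2
    rw [h2] at h1
    exact hy F hF w hw hwA (by linarith)
  let N : ℝ → ℕ := fun t => (𝓕.filter fun F => InsideGerm x A F (y + t • (z - y)) (z - y)).card
  have hN : IsLocallyConstant N := by
    rw [IsLocallyConstant.iff_eventually_eq]
    intro t
    have hbal : N t = (𝓕.filter fun F =>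
        InsideGerm x A F (y + t • (z - y)) (-(z - y))).card := by
      refine le_antisymm (h.card_germ_le (hone t)) ?_
      have := h.card_germ_le (u := -(z - y)) (hone t)
      rwa [neg_neg] at this
    have hright : ∀ᶠ s in 𝓝[>] t, N s = N t := by
      have : ∀ᶠ s in 𝓝[>] t, ∀ F w,
          (0 < coord x F y w + s * coord x F (z - y) w ∨
            (coord x F y w + s * coord x F (z - y) w = 0 ∧ 0 < coord x F (z - y) w)) ↔
          (0 < coord x F y w + t * coord x F (z - y) w ∨
            (coord x F y w + t * coord x F (z - y) w = 0 ∧ 0 < coord x F (z - y) w)) :=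
        eventually_all.2 fun F => eventually_all.2 fun w => eventually_right_germ _ _ _
      filter_upwards [this] with s hs
      refine congrArg Finset.card (Finset.filter_congr fun F _ => ?_)
      simp only [InsideGerm, hlin]
      exact forall_congr' fun w => by rw [hs F w]
    have hleft : ∀ᶠ s in 𝓝[<] t, N s = N t := by
      have : ∀ᶠ s in 𝓝[<] t, ∀ F w, F ∈ 𝓕 → w ∈ F → w ∉ A →
          ((0 < coord x F y w + s * coord x F (z - y) w ∨
            (coord x F y w + s * coord x F (z - y) w = 0 ∧ 0 < coord x F (z - y) w)) ↔
          (0 < coord x F y w + t * coord x F (z - y) w ∨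
            (coord x F y w + t * coord x F (z - y) w = 0 ∧ 0 < -coord x F (z - y) w))) := by
        refine eventually_all.2 fun F => eventually_all.2 fun w => ?_
        by_cases hc : F ∈ 𝓕 ∧ w ∈ F ∧ w ∉ A
        · filter_upwards [eventually_left_germ (hslope t F hc.1 w hc.2.1 hc.2.2)] with s hs
          exact fun _ _ _ => hs
        · exact Eventually.of_forall fun s h1 h2 h3 => absurd ⟨h1, h2, h3⟩ hc
      filter_upwards [this] with s hs
      rw [hbal]
      refine congrArg Finset.card (Finset.filter_congr fun F hF => ?_)
      simp only [InsideGerm, hlin, map_neg, Pi.neg_apply]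
      exact forall_congr' fun w => forall_congr' fun hw => forall_congr' fun hwA =>
        hs F w hF hw hwA
    have hne : ∀ᶠ s in 𝓝[≠] t, N s = N t := by
      rw [← Set.Iio_union_Ioi, nhdsWithin_union]
      exact eventually_sup.2 ⟨hleft, hright⟩
    rw [eventually_nhdsWithin_iff] at hne
    filter_upwards [hne] with s hs
    by_cases hst : s = t
    · rw [hst]
    · exact hs hst
  have h01 := hN.apply_eq_of_preconnectedSpace 0 1
  have hcount : ∀ (t : ℝ) (v : Fin n → ℝ), y + t • (z - y) = v → IsGeneric x A 𝓕 v →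
      N t = coverCount x A 𝓕 v := by
    rintro t v rfl hv
    refine congrArg Finset.card (Finset.filter_congr fun F hF => ?_)
    refine forall_congr' fun w => forall_congr' fun hw => forall_congr' fun hwA => ?_
    exact or_iff_left fun h' => hv F hF w hw hwA h'.1
  rwa [hcount 0 y (by simp) hy, hcount 1 z (by simp) hz] at h01

theorem IsCrossing.ae_isGeneric (h : IsCrossing x A 𝓕) : ∀ᵐ y, IsGeneric x A 𝓕 y := by
  have : ∀ F w, ∀ᵐ y, F ∈ 𝓕 → w ∈ F → w ∉ A → coord x F y w ≠ 0 := by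
    intro F w
    by_cases hc : F ∈ 𝓕 ∧ w ∈ F
    · have hne : LinearMap.proj w ∘ₗ coord x F ≠ 0 := fun h0 => by
        have := LinearMap.congr_fun h0 (x w)
        simp [coord_self (h.basis F hc.1).indep hc.2] at this
      filter_upwards [ae_ne_zero hne] with y hy _ _ _
      exact hy
    · exact Eventually.of_forall fun y h1 h2 => absurd ⟨h1, h2⟩ hc
  filter_upwards [eventually_countable_forall.2 fun F => eventually_countable_forall.2 (this F)]
    with y hy F hF w hw hwA
  exact hy F w hF hw hwA

/-- All generic vectors are covered by the same number of cones. -/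
theorem IsCrossing.coverCount_eq (h : IsCrossing x A 𝓕) {y z : Fin n → ℝ}
    (hy : IsGeneric x A 𝓕 y) (hz : IsGeneric x A 𝓕 z) :
    coverCount x A 𝓕 y = coverCount x A 𝓕 z := by
  have key : ∀ y, IsGeneric x A 𝓕 y → ∀ᵐ v, ∀ F w u, F ∈ 𝓕 → w ∈ F → w ∉ A → u ∈ F → u ∉ A →
      w ≠ u → coord x F y w * coord x F v u ≠ coord x F y u * coord x F v w := by
    intro y hy
    refine eventually_countable_forall.2 fun F => eventually_countable_forall.2 fun w =>
      eventually_countable_forall.2 fun u => ?_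
    by_cases hc : F ∈ 𝓕 ∧ w ∈ F ∧ w ∉ A ∧ u ∈ F ∧ w ≠ u
    · obtain ⟨hF, hw, hwA, hu, hwu⟩ := hc
      have hne : coord x F y w • (LinearMap.proj u ∘ₗ coord x F) -
          coord x F y u • (LinearMap.proj w ∘ₗ coord x F) ≠ 0 := fun h0 => by
        have := LinearMap.congr_fun h0 (x u)
        simp [coord_self (h.basis F hF).indep hu, hwu] at this
        exact hy F hF w hw hwA this
      filter_upwards [ae_ne_zero hne] with v hv _ _ _ _ _ _
      exact sub_ne_zero.1 hv
    · exact Eventually.of_forall fun v h1 h2 h3 h4 _ h6 => absurd ⟨h1, h2, h3, h4, h6⟩ hc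
  obtain ⟨v, hv, hyv, hzv⟩ := (h.ae_isGeneric.and ((key y hy).and (key z hz))).exists
  exact (h.coverCount_eq_of_line hy hv fun F hF w hw hwA u hu huA hwu =>
    hyv F w u hF hw hwA hu huA hwu).trans
    (h.coverCount_eq_of_line hz hv fun F hF w hw hwA u hu huA hwu =>
      hzv F w u hF hw hwA hu huA hwu).symm

end Count


/-! ### Complete fans as local fans of degree one -/

section Fans

open MeasureTheory Filter Topology

variable {W : Type} {n : ℕ} {K : Cpx W} {x : W → Fin n → ℝ}

theorem IsCompleteFan.card_le (hx : IsCompleteFan K x) {σ : Finset W} (hσ : σ ∈ K) :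
    σ.card ≤ n := by
  have := (hx.linearIndependent σ hσ).fintype_card_le_finrank
  simpa using this

theorem IsCompleteFan.isBasisOn (hx : IsCompleteFan K x) {F : Finset W} (hF : F ∈ K)
    (hc : F.card = n) : IsBasisOn x F :=
  ⟨hx.linearIndependent F hF, hc⟩

theorem card_exchange [DecidableEq W] {F : Finset W} {w w' : W} (hw : w ∈ F) (hw' : w' ∉ F) :
    (insert w' (F.erase w)).card = F.card := by
  rw [Finset.card_insert_of_notMem fun h => hw' (Finset.mem_of_mem_erase h),
    Finset.card_erase_add_one hw]

variable [Fintype W] [DecidableEq W]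

/-- The combinatorial features of a triangulated sphere that matter here: the complex is pure, and
each face with `n - 1` vertices lies in exactly two faces with `n` vertices. -/
structure IsPseudomanifold {W : Type} [DecidableEq W] (n : ℕ) (K : Cpx W) : Prop where
  empty_mem : ∅ ∈ K
  pure : ∀ σ ∈ K, ∃ F ∈ K, σ ⊆ F ∧ F.card = n
  exists_exchange : ∀ F ∈ K, F.card = n → ∀ w ∈ F, ∃ w', w' ∉ F ∧ insert w' (F.erase w) ∈ K
  exchange_unique : ∀ F ∈ K, F.card = n → ∀ w ∈ F, ∀ w' w'', w' ∉ F → w'' ∉ F →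
    insert w' (F.erase w) ∈ K → insert w'' (F.erase w) ∈ K → w' = w''

/-- The cones over the facets are simplicial, and cones over adjacent facets lie on different sides
of the wall between them. -/
structure IsLocalFan (K : Cpx W) (x : W → Fin n → ℝ) : Prop where
  indep : ∀ F ∈ K, F.card = n → LinearIndependent ℝ (fun v : F => x v)
  opposite : ∀ F ∈ K, F.card = n → ∀ w ∈ F, ∀ w', w' ∉ F → insert w' (F.erase w) ∈ K →
    coord x F (x w') w < 0

open Classical in
/-- The faces with `n` vertices that contain `A`. -/
noncomputable def facetsThrough (n : ℕ) (K : Cpx W) (A : Finset W) : Finset (Finset W) :=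
  Finset.univ.filter fun F => F ∈ K ∧ F.card = n ∧ A ⊆ F

theorem mem_facetsThrough {A F : Finset W} :
    F ∈ facetsThrough n K A ↔ F ∈ K ∧ F.card = n ∧ A ⊆ F := by
  simp [facetsThrough]

theorem IsLocalFan.isCrossing (hK : IsPseudomanifold n K) (hx : IsLocalFan K x) (A : Finset W) :
    IsCrossing x A (facetsThrough n K A) where
  basis F hF := by
    rw [mem_facetsThrough] at hF
    exact ⟨hx.indep F hF.1 hF.2.1, hF.2.1⟩
  subset F hF := (mem_facetsThrough.1 hF).2.2
  exchange F hF w hw hwA := by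
    rw [mem_facetsThrough] at hF
    obtain ⟨hF, hc, hAF⟩ := hF
    obtain ⟨w', hw', hG⟩ := hK.exists_exchange F hF hc w hw
    refine ⟨w', hw', mem_facetsThrough.2 ⟨hG, by rw [card_exchange hw hw', hc], ?_⟩,
      hx.opposite F hF hc w hw w' hw' hG, fun w'' hw'' hG'' => ?_⟩
    · intro v hv
      refine Finset.mem_insert_of_mem (Finset.mem_erase.2 ⟨?_, hAF hv⟩)
      rintro rfl
      exact hwA hv
    · exact hK.exchange_unique F hF hc w hw w'' w' hw'' hw' (mem_facetsThrough.1 hG'').1 hG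

theorem sum_indicator_smul (F : Finset W) (x : W → Fin n → ℝ) :
    ∑ w, (if w ∈ F then (1 : ℝ) else 0) • x w = ∑ w ∈ F, x w := by
  rw [sum_eq_sum_of_supported (F := F) fun w hw => if_neg hw]
  exact Finset.sum_congr rfl fun w hw => by rw [if_pos hw, one_smul]

theorem mem_hull_iff {F : Finset W} {y : Fin n → ℝ} :
    y ∈ PointedCone.hull ℝ (x '' (F : Set W)) ↔
      ∃ a : W → ℝ, (∀ w, 0 ≤ a w) ∧ (∀ w, w ∉ F → a w = 0) ∧ ∑ w, a w • x w = y := by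
  rw [PointedCone.hull, Submodule.mem_span_image_finset_iff_exists_fun]
  constructor
  · rintro ⟨c, hc⟩
    refine ⟨fun w => if h : w ∈ F then (c ⟨w, h⟩ : ℝ) else 0, fun w => ?_,
      fun w hw => dif_neg hw, ?_⟩
    · dsimp only
      split_ifs with h
      · exact (c ⟨w, h⟩).2
      · exact le_rfl
    · rw [sum_eq_sum_of_supported (F := F) (fun v hv => dif_neg hv), ← hc, ← Finset.sum_coe_sort F]
      refine Finset.sum_congr rfl fun v _ => ?_
      rw [dif_pos v.2]
      rfl
  · rintro ⟨a, ha, haF, rfl⟩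
    refine ⟨fun v => ⟨a v, ha v⟩, ?_⟩
    rw [sum_eq_sum_of_supported haF]
    exact Finset.sum_coe_sort F (fun v => a v • x v)

theorem hull_le_span {F : Finset W} {y : Fin n → ℝ}
    (hy : y ∈ PointedCone.hull ℝ (x '' (F : Set W))) :
    y ∈ Submodule.span ℝ (x '' (F : Set W)) := by
  obtain ⟨a, -, ha, hs⟩ := mem_hull_iff.1 hy
  exact (mem_span_image_iff_supported F x y).2 ⟨a, ha, hs⟩

theorem coord_nonneg_of_mem_hull {F : Finset W} (hF : LinearIndependent ℝ (fun v : F => x v))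
    {y : Fin n → ℝ} (hy : y ∈ PointedCone.hull ℝ (x '' (F : Set W))) (w : W) :
    0 ≤ coord x F y w := by
  obtain ⟨a, ha, haF, rfl⟩ := mem_hull_iff.1 hy
  rw [coord_sum hF haF]
  exact ha w

theorem mem_hull_of_coord_nonneg {F : Finset W} (hF : LinearIndependent ℝ (fun v : F => x v))
    {y : Fin n → ℝ} (hy : y ∈ Submodule.span ℝ (x '' (F : Set W)))
    (h : ∀ w ∈ F, 0 ≤ coord x F y w) : y ∈ PointedCone.hull ℝ (x '' (F : Set W)) := by
  refine mem_hull_iff.2 ⟨coord x F y, fun w => ?_, fun w hw => coord_of_notMem y hw,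
    sum_coord_of_mem_span hF hy⟩
  by_cases hw : w ∈ F
  · exact h w hw
  · rw [coord_of_notMem y hw]

/-- A simplicial cone is closed, tested along a segment. -/
theorem mem_hull_of_frequently {F : Finset W} (hF : LinearIndependent ℝ (fun v : F => x v))
    {p u : Fin n → ℝ}
    (h : ∃ᶠ ε : ℝ in 𝓝[>] 0, p + ε • u ∈ PointedCone.hull ℝ (x '' (F : Set W))) :
    p ∈ PointedCone.hull ℝ (x '' (F : Set W)) ∧
      ∃ ε : ℝ, 0 < ε ∧ p + ε • u ∈ PointedCone.hull ℝ (x '' (F : Set W)) := by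
  obtain ⟨ε, hε, hεpos⟩ := (h.and_eventually self_mem_nhdsWithin).exists
  have hεpos' : 0 < ε := hεpos
  refine ⟨?_, ε, hεpos, hε⟩
  obtain ⟨δ, hδ, hδε⟩ := (h.and_eventually
    (eventually_nhdsWithin_of_eventually_nhds (eventually_lt_nhds hεpos'))).exists
  have hspan : p ∈ Submodule.span ℝ (x '' (F : Set W)) := by
    have h1 := Submodule.sub_mem _ (hull_le_span hε) (hull_le_span hδ)
    have h2 : p + ε • u - (p + δ • u) = (ε - δ) • u := by
      rw [sub_smul]
      abel
    rw [h2, Submodule.smul_mem_iff _ (sub_pos.2 hδε).ne'] at h1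
    have h3 := Submodule.sub_mem _ (hull_le_span hε) (Submodule.smul_mem _ ε h1)
    rwa [add_sub_cancel_right] at h3
  refine mem_hull_of_coord_nonneg hF hspan fun w _ => ?_
  by_contra! hneg
  have hc : Tendsto (fun s : ℝ => coord x F p w + s * coord x F u w) (𝓝[>] 0)
      (𝓝 (coord x F p w + 0 * coord x F u w)) :=
    ((continuous_const.add (continuous_id.mul continuous_const)).tendsto 0).mono_left
      nhdsWithin_le_nhds
  rw [zero_mul, add_zero] at hc
  obtain ⟨s, hs, hs'⟩ := (h.and_eventually (hc.eventually_lt_const hneg)).exists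
  have := coord_nonneg_of_mem_hull hF hs w
  simp only [map_add, map_smul, Pi.add_apply, Pi.smul_apply, smul_eq_mul] at this
  linarith

/-- Going from a relatively interior point of the cone over a face in any direction, one stays in
the star of the face for a while. -/
theorem IsCompleteFan.exists_face_of_direction (hx : IsCompleteFan K x) {σ : Finset W}
    (hσ : σ ∈ K) (u : Fin n → ℝ) :
    ∃ τ ∈ K, σ ⊆ τ ∧ ∃ ε : ℝ, 0 < ε ∧
      (∑ w ∈ σ, x w) + ε • u ∈ PointedCone.hull ℝ (x '' (τ : Set W)) := by
  have h1 : ∃ τ : Finset W, τ ∈ K ∧ ∃ᶠ ε : ℝ in 𝓝[>] 0,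
      (∑ w ∈ σ, x w) + ε • u ∈ PointedCone.hull ℝ (x '' (τ : Set W)) := by
    by_contra! hno
    have : ∀ᶠ ε : ℝ in 𝓝[>] 0, ∀ τ : Finset W, τ ∈ K →
        (∑ w ∈ σ, x w) + ε • u ∉ PointedCone.hull ℝ (x '' (τ : Set W)) := by
      refine eventually_all.2 fun τ => ?_
      by_cases hτ : τ ∈ K
      · filter_upwards [hno τ hτ] with ε hε _
        exact hε
      · exact Eventually.of_forall fun ε h => absurd h hτ
    obtain ⟨ε, hε⟩ := this.exists
    obtain ⟨τ, hτ, hy⟩ := hx.cover ((∑ w ∈ σ, x w) + ε • u)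
    exact hε τ hτ hy
  obtain ⟨τ, hτ, hfreq⟩ := h1
  obtain ⟨hp, hε⟩ := mem_hull_of_frequently (hx.linearIndependent τ hτ) hfreq
  refine ⟨τ, hτ, ?_, hε⟩
  have hsum := sum_indicator_smul σ x
  have hpσ : (∑ w ∈ σ, x w) ∈ PointedCone.hull ℝ (x '' (σ : Set W)) :=
    mem_hull_iff.2 ⟨fun w => if w ∈ σ then 1 else 0, fun w => by positivity,
      fun w hw => if_neg hw, hsum⟩
  have hin : (∑ w ∈ σ, x w) ∈ (PointedCone.hull ℝ (x '' ((σ : Set W) ∩ (τ : Set W))) : Set _) :=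
    hx.inter σ hσ τ hτ ▸ ⟨hpσ, hp⟩
  rw [← Finset.coe_inter] at hin
  obtain ⟨a, -, ha, has⟩ := mem_hull_iff.1 hin
  have h2 := coord_sum (hx.linearIndependent σ hσ) (a := a)
    fun w hw => ha w fun h => hw (Finset.mem_inter.1 h).1
  have h3 := coord_sum (hx.linearIndependent σ hσ)
    (a := fun w => if w ∈ σ then (1 : ℝ) else 0) fun w hw => if_neg hw
  rw [has] at h2
  rw [hsum, h2] at h3
  intro w hw
  by_contra hwτ
  have h4 := congrFun h3 w
  rw [ha w fun h => hwτ (Finset.mem_inter.1 h).2, if_pos hw] at h4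
  exact zero_ne_one h4

theorem IsCompleteFan.pure (hx : IsCompleteFan K x) {σ : Finset W} (hσ : σ ∈ K) :
    ∃ F ∈ K, σ ⊆ F ∧ F.card = n := by
  have hae : ∀ τ : Finset W, ∀ᵐ u : Fin n → ℝ, τ ∈ K → τ.card ≠ n →
      u ∉ Submodule.span ℝ (x '' (τ : Set W)) := by
    intro τ
    by_cases hτ : τ ∈ K ∧ τ.card ≠ n
    · have hne : Submodule.span ℝ (x '' (τ : Set W)) ≠ ⊤ := by
        intro htop
        have := finrank_span_eq_card (hx.linearIndependent τ hτ.1)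
        rw [show Set.range (fun v : τ => x v) = x '' (τ : Set W) by
          rw [Set.image_eq_range]; rfl, htop, finrank_top] at this
        simp only [Module.finrank_fin_fun, Fintype.card_coe] at this
        exact hτ.2 this.symm
      have := Measure.addHaar_submodule (volume : Measure (Fin n → ℝ)) _ hne
      filter_upwards [measure_eq_zero_iff_ae_notMem.1 this] with u hu _ _
      exact hu
    · exact Eventually.of_forall fun u h1 h2 => absurd ⟨h1, h2⟩ hτ
  obtain ⟨u, hu⟩ := (eventually_countable_forall.2 hae).exists
  obtain ⟨τ, hτ, hστ, ε, hε, hmem⟩ := hx.exists_face_of_direction hσ u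
  refine ⟨τ, hτ, hστ, ?_⟩
  by_contra hne
  refine hu τ hτ hne ?_
  have h1 : ∑ w ∈ σ, x w ∈ Submodule.span ℝ (x '' (τ : Set W)) :=
    Submodule.sum_mem _ fun w hw => Submodule.subset_span ⟨w, hστ hw, rfl⟩
  have h2 := Submodule.sub_mem _ (hull_le_span hmem) h1
  rwa [add_sub_cancel_left, Submodule.smul_mem_iff _ hε.ne'] at h2

theorem IsCompleteFan.exists_exchange (hx : IsCompleteFan K x) {F : Finset W} (hF : F ∈ K)
    (hc : F.card = n) {w : W} (hw : w ∈ F) :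
    ∃ w', w' ∉ F ∧ insert w' (F.erase w) ∈ K := by
  have hFb := hx.isBasisOn hF hc
  -- cross the wall opposite to `w`, away from `w`
  obtain ⟨τ, hτ, hστ, ε, hε, hmem⟩ := hx.exists_face_of_direction
    (K.lower (Finset.erase_subset w F) hF) (-x w)
  have hτF : ¬ τ ⊆ F := by
    intro hτF
    obtain ⟨a, ha, haτ, has⟩ := mem_hull_iff.1 hmem
    have h1 := coord_sum hFb.indep (a := a) fun v hv => haτ v fun h => hv (hτF h)
    have h2 : coord x F (∑ w ∈ F.erase w, x w) w = 0 := by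
      rw [map_sum, Finset.sum_apply]
      refine Finset.sum_eq_zero fun v hv => ?_
      rw [coord_self hFb.indep (Finset.mem_of_mem_erase hv),
        Pi.single_eq_of_ne (Finset.ne_of_mem_erase hv).symm]
    have h3 := ha w
    rw [← h1, has, map_add, Pi.add_apply, h2, map_smul, map_neg, coord_self hFb.indep hw] at h3
    simp at h3
    linarith
  obtain ⟨w', hw'τ, hw'F⟩ := Finset.not_subset.1 hτF
  exact ⟨w', hw'F, K.lower (Finset.insert_subset hw'τ hστ) hτ⟩

/-- If two adjacent cones lay on the same side of their common wall, they would overlap. -/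
theorem IsCompleteFan.opposite (hx : IsCompleteFan K x) {F : Finset W} (hF : F ∈ K)
    (hc : F.card = n) {w w' : W} (hw : w ∈ F) (hw' : w' ∉ F)
    (hG : insert w' (F.erase w) ∈ K) : coord x F (x w') w < 0 := by
  have hFb := hx.isBasisOn hF hc
  have hGb := hx.isBasisOn hG (by rw [card_exchange hw hw', hc])
  have hne := coord_exchange_ne_zero hFb hw hw' hGb
  by_contra! hle
  have hpos : 0 < coord x F (x w') w := lt_of_le_of_ne hle hne.symm
  let M : ℝ := ∑ v, |coord x F (x w') v|
  have hM : ∀ v, -coord x F (x w') v ≤ M := fun v =>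
    (neg_le_abs _).trans (Finset.single_le_sum (f := fun v => |coord x F (x w') v|)
      (fun _ _ => abs_nonneg _) (Finset.mem_univ v))
  have hM0 : 0 ≤ M := Finset.sum_nonneg fun _ _ => abs_nonneg _
  let z : Fin n → ℝ := M • ∑ v ∈ F.erase w, x v + x w'
  have hcoord : ∀ v, coord x F z v = (if v ∈ F.erase w then M else 0) + coord x F (x w') v := by
    intro v
    simp only [z, map_add, map_smul, map_sum, Pi.add_apply, Pi.smul_apply, Finset.sum_apply,
      smul_eq_mul, Finset.mul_sum]
    congr 1
    have : ∀ u ∈ F.erase w, M * coord x F (x u) v = if v = u then M else 0 := fun u hu => by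
      rw [coord_self hFb.indep (Finset.mem_of_mem_erase hu), Pi.single_apply]
      simp
    rw [Finset.sum_congr rfl this, Finset.sum_ite_eq]
  have hzF : z ∈ PointedCone.hull ℝ (x '' (F : Set W)) := by
    refine mem_hull_of_coord_nonneg hFb.indep (hFb.span_eq_top ▸ Submodule.mem_top)
      fun v hv => ?_
    rw [hcoord]
    by_cases hvw : v = w
    · rw [hvw, if_neg (Finset.notMem_erase w F), zero_add]
      exact hle
    · rw [if_pos (Finset.mem_erase.2 ⟨hvw, hv⟩)]
      linarith [hM v]
  have hzG : z ∈ PointedCone.hull ℝ (x '' (insert w' (F.erase w) : Finset W)) := by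
    refine Submodule.add_mem _ ?_ (Submodule.subset_span ⟨w', by simp, rfl⟩)
    refine PointedCone.smul_mem _ hM0 (Submodule.sum_mem _ fun v hv => ?_)
    exact Submodule.subset_span ⟨v, Finset.mem_coe.2 (Finset.mem_insert_of_mem hv), rfl⟩
  have hin : z ∈ (PointedCone.hull ℝ
      (x '' ((F : Set W) ∩ ((insert w' (F.erase w) : Finset W) : Set W))) : Set _) :=
    hx.inter F hF _ hG ▸ ⟨hzF, hzG⟩
  rw [← Finset.coe_inter] at hin
  obtain ⟨a, -, ha, has⟩ := mem_hull_iff.1 hin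
  have h1 := coord_sum hFb.indep (a := a) fun v hv => ha v fun h => hv (Finset.mem_inter.1 h).1
  have h2 := hcoord w
  rw [if_neg (Finset.notMem_erase w F), zero_add, ← has, h1, ha w] at h2
  · exact hne h2.symm
  · rw [Finset.mem_inter, Finset.mem_insert]
    rintro ⟨-, rfl | h⟩
    · exact hw' hw
    · exact Finset.notMem_erase w F h

theorem IsCompleteFan.isLocalFan (hx : IsCompleteFan K x) : IsLocalFan K x where
  indep F hF _ := hx.linearIndependent F hF
  opposite _ hF hc _ hw _ hw' hG := hx.opposite hF hc hw hw' hG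

theorem IsCompleteFan.isPseudomanifold (hx : IsCompleteFan K x) : IsPseudomanifold n K where
  empty_mem := by
    obtain ⟨σ, hσ, -⟩ := hx.cover 0
    exact K.lower (Finset.empty_subset σ) hσ
  pure _ hσ := hx.pure hσ
  exists_exchange _ hF hc _ hw := hx.exists_exchange hF hc hw
  exchange_unique F hF hc w hw w' w'' hw' hw'' hG' hG'' := by
    by_contra hne
    have hc' := hc ▸ card_exchange hw hw'
    have hw1 : w' ∈ insert w' (F.erase w) := Finset.mem_insert_self _ _
    have hw2 : w'' ∉ insert w' (F.erase w) := by
      rw [Finset.mem_insert, not_or]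
      exact ⟨fun h => hne h.symm, fun h => hw'' (Finset.mem_of_mem_erase h)⟩
    have he : (insert w' (F.erase w)).erase w' = F.erase w :=
      Finset.erase_insert fun h => hw' (Finset.mem_of_mem_erase h)
    have h1 := hx.opposite hF hc hw hw' hG'
    have h2 := hx.opposite hF hc hw hw'' hG''
    have h3 := hx.opposite hG' hc' hw1 hw2 (by rwa [he])
    rw [coord_exchange_self (hx.isBasisOn hF hc) hw' (hx.isBasisOn hG' hc')] at h2
    exact absurd h2 (not_lt.2 (mul_nonneg_of_nonpos_of_nonpos h3.le h1.le))

theorem IsCompleteFan.inside_unique (hx : IsCompleteFan K x) {F G : Finset W} (hF : F ∈ K)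
    (hFc : F.card = n) (hG : G ∈ K) (hGc : G.card = n) {y : Fin n → ℝ} (hyF : Inside x ∅ F y)
    (hyG : Inside x ∅ G y) : F = G := by
  have hmem : ∀ H ∈ K, H.card = n → Inside x ∅ H y →
      y ∈ PointedCone.hull ℝ (x '' (H : Set W)) := fun H hH hc hy =>
    mem_hull_of_coord_nonneg (hx.linearIndependent H hH)
      ((hx.isBasisOn hH hc).span_eq_top ▸ Submodule.mem_top)
      fun w hw => (hy w hw (Finset.notMem_empty w)).le
  have hin : y ∈ (PointedCone.hull ℝ (x '' ((F : Set W) ∩ (G : Set W))) : Set _) :=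
    hx.inter F hF G hG ▸ ⟨hmem F hF hFc hyF, hmem G hG hGc hyG⟩
  rw [← Finset.coe_inter] at hin
  obtain ⟨a, -, ha, rfl⟩ := mem_hull_iff.1 hin
  refine Finset.eq_of_subset_of_card_le (fun w hw => ?_) (by rw [hFc, hGc])
  by_contra hwG
  have h1 := hyF w hw (Finset.notMem_empty w)
  rw [coord_sum (hx.linearIndependent F hF) fun v hv =>
    ha v fun h => hv (Finset.mem_inter.1 h).1, ha w fun h => hwG (Finset.mem_inter.1 h).2] at h1
  exact lt_irrefl _ h1

theorem exists_isGeneric_inside {A F : Finset W} {𝓕 : Finset (Finset W)} (h : IsCrossing x A 𝓕)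
    (hF : F ∈ 𝓕) : ∃ y, IsGeneric x A 𝓕 y ∧ Inside x A F y := by
  have hind := (h.basis F hF).indep
  have hopen : IsOpen {y : Fin n → ℝ | ∀ w : F, 0 < coord x F y w} := by
    simp only [Set.ofPred_forall]
    refine isOpen_iInter_of_finite fun w => isOpen_lt continuous_const ?_
    exact (continuous_apply _).comp (coord x F).continuous_of_finiteDimensional
  obtain ⟨y, hy, hyg⟩ := exists_mem_of_ae h.ae_isGeneric hopen ⟨∑ w ∈ F, x w, fun w => by
    rw [← sum_indicator_smul F x, coord_sum hind fun w hw => if_neg hw]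
    simp⟩
  exact ⟨y, hyg, fun w hw _ => hy ⟨w, hw⟩⟩

theorem exists_inside_of_isGeneric {A : Finset W} {𝓕 : Finset (Finset W)} (h : IsCrossing x A 𝓕)
    (hne : 𝓕.Nonempty) {y : Fin n → ℝ} (hy : IsGeneric x A 𝓕 y) : ∃ F ∈ 𝓕, Inside x A F y := by
  classical
  obtain ⟨F, hF⟩ := hne
  obtain ⟨z, hz, hzF⟩ := exists_isGeneric_inside h hF
  have hpos : 0 < coverCount x A 𝓕 z := Finset.card_pos.2 ⟨F, Finset.mem_filter.2 ⟨hF, hzF⟩⟩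
  rw [← h.coverCount_eq hy hz] at hpos
  obtain ⟨G, hG⟩ := Finset.card_pos.1 hpos
  exact ⟨G, (Finset.mem_filter.1 hG).1, (Finset.mem_filter.1 hG).2⟩

/-- The facets of a complete fan are connected through walls: the cones of a family that is closed
under crossing walls cover everything. -/
theorem IsCompleteFan.facet_induction (hx : IsCompleteFan K x) {P : Finset W → Prop}
    (hbase : ∃ F ∈ K, F.card = n ∧ P F)
    (hstep : ∀ F ∈ K, F.card = n → P F → ∀ w ∈ F, ∀ w', w' ∉ F → insert w' (F.erase w) ∈ K →
      P (insert w' (F.erase w))) {T : Finset W} (hT : T ∈ K) (hTc : T.card = n) : P T := by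
  classical
  have hall := hx.isLocalFan.isCrossing hx.isPseudomanifold ∅
  have hcross : IsCrossing x ∅ ((facetsThrough n K ∅).filter P) :=
    { basis := fun F hF => hall.basis F (Finset.mem_filter.1 hF).1
      subset := fun F _ => Finset.empty_subset F
      exchange := fun F hF w hw hwA => by
        obtain ⟨hF, hP⟩ := Finset.mem_filter.1 hF
        obtain ⟨w', hw', hG, hneg, huniq⟩ := hall.exchange F hF w hw hwA
        rw [mem_facetsThrough] at hF
        exact ⟨w', hw', Finset.mem_filter.2 ⟨hG, hstep F hF.1 hF.2.1 hP w hw w' hw'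
          (mem_facetsThrough.1 hG).1⟩, hneg,
          fun w'' hw'' hG'' => huniq w'' hw'' (Finset.mem_filter.1 hG'').1⟩ }
  obtain ⟨y, hy, hyT⟩ := exists_isGeneric_inside hall
    (mem_facetsThrough.2 ⟨hT, hTc, Finset.empty_subset T⟩)
  obtain ⟨F₀, hF₀, hF₀c, hP⟩ := hbase
  obtain ⟨G, hG, hyG⟩ := exists_inside_of_isGeneric hcross
    ⟨F₀, Finset.mem_filter.2 ⟨mem_facetsThrough.2 ⟨hF₀, hF₀c, Finset.empty_subset _⟩, hP⟩⟩
    (fun F hF => hy F (Finset.mem_filter.1 hF).1)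
  obtain ⟨hG, hGP⟩ := Finset.mem_filter.1 hG
  rw [mem_facetsThrough] at hG
  rwa [hx.inside_unique hT hTc hG.1 hG.2.1 hyT hyG]

/-- A local fan that covers some generic vector at most once is a complete fan. -/
theorem IsLocalFan.isCompleteFan (hK : IsPseudomanifold n K) (hx : IsLocalFan K x)
    (hcount : ∃ y, IsGeneric x ∅ (facetsThrough n K ∅) y ∧
      coverCount x ∅ (facetsThrough n K ∅) y ≤ 1) : IsCompleteFan K x := by
  classical
  have hcross := hx.isCrossing hK
  have hne : ∀ A ∈ K, (facetsThrough n K A).Nonempty := fun A hA => by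
    obtain ⟨F, hF, hAF, hc⟩ := hK.pure A hA
    exact ⟨F, mem_facetsThrough.2 ⟨hF, hc, hAF⟩⟩
  have hgen : ∀ (y : Fin n → ℝ) {d : Fin n → ℝ}, IsGeneric x ∅ (facetsThrough n K ∅) d →
      ∀ᶠ ε : ℝ in 𝓝[>] 0, IsGeneric x ∅ (facetsThrough n K ∅) (y + ε • d) := by
    intro y d hd
    refine eventually_all.2 fun F => ?_
    by_cases hF : F ∈ facetsThrough n K ∅
    · have : ∀ᶠ ε : ℝ in 𝓝[>] 0, ∀ w, w ∈ F → w ∉ (∅ : Finset W) →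
          coord x F (y + ε • d) w ≠ 0 := by
        refine eventually_all.2 fun w => ?_
        by_cases hw : w ∈ F
        · have hd' := hd F hF w hw (Finset.notMem_empty w)
          have hev : ∀ᶠ ε : ℝ in 𝓝[>] 0, ε ≠ -coord x F y w / coord x F d w := by
            by_cases h0 : -coord x F y w / coord x F d w = 0
            · rw [h0]
              filter_upwards [self_mem_nhdsWithin] with ε hε
              exact (show (0 : ℝ) < ε from hε).ne'
            · exact eventually_nhdsWithin_of_eventually_nhds
                ((isOpen_ne.mem_nhds (Ne.symm h0)))
          filter_upwards [hev] with ε hε _ _ h0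
          refine hε ?_
          rw [eq_div_iff hd']
          simp only [map_add, map_smul, Pi.add_apply, Pi.smul_apply, smul_eq_mul] at h0
          linarith
        · exact Eventually.of_forall fun ε h => absurd h hw
      filter_upwards [this] with ε hε _
      exact hε
    · exact Eventually.of_forall fun ε h => absurd h hF
  have hunique : ∀ y, IsGeneric x ∅ (facetsThrough n K ∅) y → ∀ F ∈ facetsThrough n K ∅,
      ∀ G ∈ facetsThrough n K ∅, Inside x ∅ F y → Inside x ∅ G y → F = G := by
    intro y hy F hF G hG hyF hyG
    obtain ⟨z, hz, hz1⟩ := hcount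
    rw [(hcross ∅).coverCount_eq hz hy] at hz1
    exact Finset.card_le_one.1 hz1 F (Finset.mem_filter.2 ⟨hF, hyF⟩) G
      (Finset.mem_filter.2 ⟨hG, hyG⟩)
  -- a relatively interior point of the cone over `A`, moved in a generic direction
  have hpush : ∀ A ∈ K, ∀ a : W → ℝ, (∀ w ∈ A, 0 < a w) → (∀ w, w ∉ A → a w = 0) →
      ∀ d, IsGeneric x A (facetsThrough n K A) d → ∃ F ∈ facetsThrough n K ∅, A ⊆ F ∧
        ∀ᶠ ε : ℝ in 𝓝[>] 0, Inside x ∅ F (∑ w, a w • x w + ε • d) := by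
    intro A hA a ha ha0 d hd
    obtain ⟨F, hF, hFd⟩ := exists_inside_of_isGeneric (hcross A) (hne A hA) hd
    rw [mem_facetsThrough] at hF
    obtain ⟨hF, hc, hAF⟩ := hF
    refine ⟨F, mem_facetsThrough.2 ⟨hF, hc, Finset.empty_subset F⟩, hAF, ?_⟩
    have hcoord : coord x F (∑ w, a w • x w) = a :=
      coord_sum (hx.indep F hF hc) fun w hw => ha0 w fun h => hw (hAF h)
    refine eventually_all.2 fun w => ?_
    simp only [map_add, hcoord, map_smul, Pi.add_apply, Pi.smul_apply, smul_eq_mul]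
    by_cases hwA : w ∈ A
    · have hc : Tendsto (fun s : ℝ => a w + s * coord x F d w) (𝓝[>] 0)
          (𝓝 (a w + 0 * coord x F d w)) :=
        ((continuous_const.add (continuous_id.mul continuous_const)).tendsto 0).mono_left
          nhdsWithin_le_nhds
      rw [zero_mul, add_zero] at hc
      filter_upwards [hc.eventually_const_lt (ha w hwA)] with s hs _ _
      exact hs
    · filter_upwards [self_mem_nhdsWithin] with s hs hw _
      rw [ha0 w hwA, zero_add]
      exact mul_pos hs (hFd w hw hwA)
  refine ⟨fun σ hσ => ?_, fun σ hσ τ hτ => ?_, fun y => ?_⟩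
  · obtain ⟨F, hF, hσF, hc⟩ := hK.pure σ hσ
    rw [linearIndependent_iff_supported]
    intro c hc'
    exact (linearIndependent_iff_supported F x).1 (hx.indep F hF hc) c
      fun w hw => hc' w fun h => hw (hσF h)
  · refine Set.Subset.antisymm ?_ (Set.subset_inter ?_ ?_)
    · rintro y ⟨hyσ, hyτ⟩
      obtain ⟨a, ha, haσ, hay⟩ := mem_hull_iff.1 hyσ
      obtain ⟨b, hb, hbτ, hby⟩ := mem_hull_iff.1 hyτ
      let A : Finset W := Finset.univ.filter fun w => a w ≠ 0
      let B : Finset W := Finset.univ.filter fun w => b w ≠ 0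
      have hmemA : ∀ w, w ∈ A ↔ a w ≠ 0 := fun w => by simp [A]
      have hmemB : ∀ w, w ∈ B ↔ b w ≠ 0 := fun w => by simp [B]
      have hA : A ∈ K := K.lower (fun w hw =>
        by_contra fun h => (hmemA w).1 hw (haσ w h)) hσ
      have hB : B ∈ K := K.lower (fun w hw =>
        by_contra fun h => (hmemB w).1 hw (hbτ w h)) hτ
      obtain ⟨d, hd, hdA, hdB⟩ := ((hcross ∅).ae_isGeneric.and
        ((hcross A).ae_isGeneric.and (hcross B).ae_isGeneric)).exists
      obtain ⟨F, hF, hAF, hFd⟩ := hpush A hA a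
        (fun w hw => lt_of_le_of_ne (ha w) ((hmemA w).1 hw).symm)
        (fun w hw => by_contra fun h => hw ((hmemA w).2 h)) d hdA
      obtain ⟨G, hG, hBG, hGd⟩ := hpush B hB b
        (fun w hw => lt_of_le_of_ne (hb w) ((hmemB w).1 hw).symm)
        (fun w hw => by_contra fun h => hw ((hmemB w).2 h)) d hdB
      rw [hay] at hFd
      rw [hby] at hGd
      obtain ⟨ε, hε, hεF, hεG⟩ := ((hgen y hd).and (hFd.and hGd)).exists
      obtain rfl := hunique _ hε F hF G hG hεF hεG
      have hind := ((hcross ∅).basis F hF).indep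
      have h1 := coord_sum hind (a := a) fun w hw =>
        by_contra fun h => hw (hAF ((hmemA w).2 h))
      have h2 := coord_sum hind (a := b) fun w hw =>
        by_contra fun h => hw (hBG ((hmemB w).2 h))
      rw [hay] at h1
      rw [hby, h1] at h2
      rw [← Finset.coe_inter]
      refine mem_hull_iff.2 ⟨a, ha, fun w hw => ?_, hay⟩
      rw [Finset.mem_inter, not_and_or] at hw
      rcases hw with hw | hw
      · exact haσ w hw
      · rw [h2]
        exact hbτ w hw
    · exact Submodule.span_mono (Set.image_mono Set.inter_subset_left)
    · exact Submodule.span_mono (Set.image_mono Set.inter_subset_right)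
  · obtain ⟨d, hd⟩ := (hcross ∅).ae_isGeneric.exists
    by_contra! hno
    have : ∀ᶠ ε : ℝ in 𝓝[>] 0, ∀ F : Finset W, F ∈ facetsThrough n K ∅ →
        y + ε • d ∉ PointedCone.hull ℝ (x '' (F : Set W)) := by
      refine eventually_all.2 fun F => ?_
      by_cases hF : F ∈ facetsThrough n K ∅
      · have hnf := mt (mem_hull_of_frequently (p := y) (u := d) ((hcross ∅).basis F hF).indep)
          fun h => hno F (mem_facetsThrough.1 hF).1 h.1
        filter_upwards [not_frequently.1 hnf] with ε hε _
        exact hε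
      · exact Eventually.of_forall fun ε h => absurd h hF
    obtain ⟨ε, hε, hεg⟩ := (this.and (hgen y hd)).exists
    obtain ⟨F, hF, hFy⟩ := exists_inside_of_isGeneric (hcross ∅) (hne ∅ hK.empty_mem) hεg
    have hb := (hcross ∅).basis F hF
    exact hε F hF (mem_hull_of_coord_nonneg hb.indep (hb.span_eq_top ▸ Submodule.mem_top)
      fun w hw => (hFy w hw (Finset.notMem_empty w)).le)

end Fans


/-! ### The walls of `K(J)` -/

section MultiWedgeExchange

variable {V : Type} [Fintype V] [DecidableEq V] {J : V → ℕ} {K : Cpx V} {n : ℕ}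

theorem starFace_update_of_mem {S : Finset V} {α : ∀ i, Fin (J i)} {i : V} (hi : i ∈ S)
    (a : Fin (J i)) : starFace S (Function.update α i a) = starFace S α := by
  ext ⟨k, c⟩
  rw [mem_starFace, mem_starFace]
  by_cases hk : k = i
  · subst hk
    simp [hi]
  · simp [Function.update_of_ne hk]

theorem starFace_mono {S T : Finset V} (h : S ⊆ T) (α : ∀ i, Fin (J i)) :
    starFace S α ⊆ starFace T α := fun x hx => by
  rw [mem_starFace] at hx ⊢
  exact hx.imp_left fun h' => h h'

theorem insert_slot_erase_of_mem {S : Finset V} {α : ∀ i, Fin (J i)} {i i' : V} (hi : i ∈ S)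
    (hi' : i' ∉ S) (a : Fin (J i)) :
    insert (slot α i') ((starFace S α).erase ⟨i, a⟩) =
      starFace (insert i' (S.erase i)) (Function.update α i a) := by
  have hne : i ≠ i' := by
    rintro rfl
    exact hi' hi
  ext ⟨k, c⟩
  simp only [Finset.mem_insert, Finset.mem_erase, mem_starFace]
  by_cases hk : k = i
  · subst hk
    simp [hi, hne, Sigma.ext_iff]
  · by_cases hk' : k = i'
    · subst hk'
      simp [Sigma.ext_iff, hi', hk, em]
    · simp [Sigma.ext_iff, hk, hk']

theorem insert_slot_erase_of_notMem {S : Finset V} {α : ∀ i, Fin (J i)} {i : V} (hi : i ∉ S)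
    {a : Fin (J i)} (ha : a ≠ α i) :
    insert (slot α i) ((starFace S α).erase ⟨i, a⟩) = starFace S (Function.update α i a) := by
  ext ⟨k, c⟩
  simp only [Finset.mem_insert, Finset.mem_erase, mem_starFace]
  by_cases hk : k = i
  · subst hk
    simp only [Sigma.ext_iff, true_and, heq_eq_eq, ne_eq, hi, false_or, Function.update_self]
    constructor
    · rintro (h | h) h'
      · exact ha (h'.symm.trans h)
      · exact h.1 h'
    · intro h
      by_cases hc : c = α k
      · exact Or.inl hc
      · exact Or.inr ⟨h, hc⟩
  · simp [Sigma.ext_iff, hk]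

/-- A vertex `i_a` of a facet of `K(J)` can be exchanged with `i'_{α i'}` only along an exchange in
`K` (if the facet contains all copies of `i`), or if `i' = i`. -/
theorem exchange_multiWedge (hJ : ∀ i, 1 ≤ J i) (hn : ∀ S ∈ K, S.card ≤ n) {S : Finset V}
    (hSc : S.card = n) {α : ∀ i, Fin (J i)} {i i' : V} {a : Fin (J i)}
    (hia : (⟨i, a⟩ : Σ i, Fin (J i)) ∈ starFace S α) (hi' : i' ∉ S)
    (hG : insert (slot α i') ((starFace S α).erase ⟨i, a⟩) ∈ K.multiWedge J) :
    (i ∈ S → insert i' (S.erase i) ∈ K) ∧ (i ∉ S → i' = i) := by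
  have hw' : slot α i' ∉ starFace S α := fun h => hi' (slot_mem_starFace.1 h)
  obtain ⟨T, hT, hTc, β, hTβ⟩ := exists_eq_starFace hJ hn hG
    (by rw [card_exchange hia hw', card_starFace hJ, hSc])
  -- `T` consists of the vertices all of whose copies belong to the new facet
  have hsub : ∀ k, k ≠ i → k ∈ insert i' S → k ∈ T := by
    intro k hki hk
    rw [← slot_mem_starFace (α := β), ← hTβ]
    by_cases hki' : k = i'
    · subst hki'
      by_cases hβ : β k = α k
      · rw [show slot β k = slot α k by simp [slot, hβ]]
        exact Finset.mem_insert_self _ _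
      · refine Finset.mem_insert_of_mem (Finset.mem_erase.2 ⟨fun h => hki (congrArg Sigma.fst h),
          mem_starFace.2 (Or.inr hβ)⟩)
    · refine Finset.mem_insert_of_mem (Finset.mem_erase.2 ⟨fun h => hki (congrArg Sigma.fst h),
        mem_starFace.2 (Or.inl ((Finset.mem_insert.1 hk).resolve_left hki'))⟩)
  constructor
  · intro hi
    refine K.lower (fun k hk => ?_) hT
    rcases Finset.mem_insert.1 hk with rfl | hk
    · exact hsub _ (by rintro rfl; exact hi' hi) (Finset.mem_insert_self _ _)
    · exact hsub k (Finset.ne_of_mem_erase hk)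
        (Finset.mem_insert_of_mem (Finset.mem_of_mem_erase hk))
  · intro hi
    by_contra hne
    have h1 : insert i' S ⊆ T := fun k hk => by
      refine hsub k ?_ hk
      rintro rfl
      rcases Finset.mem_insert.1 hk with h | h
      · exact hne h.symm
      · exact hi h
    have h2 := Finset.card_le_card h1
    rw [Finset.card_insert_of_notMem hi', hSc, hTc] at h2
    omega

theorem IsPseudomanifold.card_le {W : Type} [DecidableEq W] {K : Cpx W}
    (hK : IsPseudomanifold n K) : ∀ S ∈ K, S.card ≤ n := fun S hS => by
  obtain ⟨F, -, hSF, hc⟩ := hK.pure S hS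
  exact hc ▸ Finset.card_le_card hSF

theorem IsPseudomanifold.multiWedge (hK : IsPseudomanifold n K) (hJ : ∀ i, 1 ≤ J i) :
    IsPseudomanifold (n + ∑ i, (J i - 1)) (K.multiWedge J) where
  empty_mem := (K.multiWedge J).lower (Finset.empty_subset _)
    (starFace_mem hK.empty_mem fun i => ⟨0, hJ i⟩)
  pure F hF := by
    obtain ⟨S, hS, α, hFS⟩ := exists_subset_starFace hJ hF
    obtain ⟨T, hT, hST, hTc⟩ := hK.pure S hS
    exact ⟨starFace T α, starFace_mem hT α, hFS.trans (starFace_mono hST α),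
      by rw [card_starFace hJ, hTc]⟩
  exists_exchange F hF hc w hw := by
    obtain ⟨S, hS, hSc, α, rfl⟩ := exists_eq_starFace hJ hK.card_le hF hc
    obtain ⟨i, a⟩ := w
    by_cases hi : i ∈ S
    · obtain ⟨i', hi', hT⟩ := hK.exists_exchange S hS hSc i hi
      refine ⟨slot α i', fun h => hi' (slot_mem_starFace.1 h), ?_⟩
      rw [insert_slot_erase_of_mem hi hi']
      exact starFace_mem hT _
    · refine ⟨slot α i, fun h => hi (slot_mem_starFace.1 h), ?_⟩
      rw [insert_slot_erase_of_notMem hi ((mem_starFace.1 hw).resolve_left hi)]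
      exact starFace_mem hS _
  exchange_unique F hF hc w hw w' w'' hw' hw'' hG' hG'' := by
    obtain ⟨S, hS, hSc, α, rfl⟩ := exists_eq_starFace hJ hK.card_le hF hc
    obtain ⟨i, a⟩ := w
    obtain ⟨h1, h2⟩ := eq_slot_of_notMem_starFace hw'
    obtain ⟨h3, h4⟩ := eq_slot_of_notMem_starFace hw''
    rw [h2] at hG'
    rw [h4] at hG''
    have k1 := exchange_multiWedge hJ hK.card_le hSc hw h1 hG'
    have k2 := exchange_multiWedge hJ hK.card_le hSc hw h3 hG''
    rw [h2, h4]
    by_cases hi : i ∈ S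
    · rw [hK.exchange_unique S hS hSc i hi _ _ h1 h3 (k1.1 hi) (k2.1 hi)]
    · rw [k1.2 hi, k2.2 hi]

end MultiWedgeExchange

/-! ### Signs of relations at the walls of `K(J)` -/

section Opposite

variable {V : Type} [DecidableEq V] {n : ℕ}

/-- The vectors `l w` and `l w'` of two adjacent facets lie on opposite sides of their common wall,
expressed by the linear relation between the `n + 1` vectors involved: its coefficients at `w` and
`w'` have the same sign. -/
def IsOpposite (n : ℕ) (K : Cpx V) (M : Submodule ℤ (V → ℤ)) : Prop :=
  ∀ F ∈ K, F.card = n → ∀ w ∈ F, ∀ w', w' ∉ F → insert w' (F.erase w) ∈ K →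
    ∀ c ∈ M, (∀ v, v ∉ insert w' F → c v = 0) → c w' ≠ 0 → 0 < c w * c w'

variable {K : Cpx V} {J : V → ℕ}

/-- The transport step for the sign of `c j_{α j} * c j_{β j}`, where `β` differs from `α` only at
`j`: crossing a wall of `K` between two facets that do not contain `j` does not change it. -/
theorem pos_of_exchange {M : Submodule ℤ ((Σ i, Fin (J i)) → ℤ)} {α β : ∀ i, Fin (J i)} {j : V}
    (hαβ : ∀ k, k ≠ j → β k = α k)
    (hα : IsOpposite n K (M.map (res ℤ α))) (hβ : IsOpposite n K (M.map (res ℤ β)))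
    {S : Finset V} (hS : S ∈ K) (hSc : S.card = n) (hcα : IsCobasis (M.map (res ℤ α)) S)
    (hcβ : IsCobasis (M.map (res ℤ β)) S) {w w' : V} (hw : w ∈ S) (hw' : w' ∉ S)
    (hT : insert w' (S.erase w) ∈ K) (hjS : j ∉ S) (hjw' : j ≠ w')
    (hP : ∀ c ∈ M, (∀ k, k ∉ insert j S → res ℤ α c k = 0) → res ℤ α c j ≠ 0 →
      0 < res ℤ α c j * res ℤ β c j) :
    ∀ c ∈ M, (∀ k, k ∉ insert j (insert w' (S.erase w)) → res ℤ α c k = 0) →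
      res ℤ α c j ≠ 0 → 0 < res ℤ α c j * res ℤ β c j := by
  intro c hc hsupp hcj
  have hag : ∀ (d : (Σ i, Fin (J i)) → ℤ) k, k ≠ j → res ℤ β d k = res ℤ α d k :=
    fun d k hk => by rw [res_apply, res_apply, hαβ k hk]
  have hwj : w ≠ j := by
    rintro rfl
    exact hjS hw
  have hww' : w ≠ w' := by
    rintro rfl
    exact hw' hw
  -- the relations on `S ∪ {w'}` with coefficient `1` at `w'`, for `α` and for `β`
  obtain ⟨_, ⟨⟨v, hv, rfl⟩, hvS⟩, -⟩ := hcα (Pi.single w' 1)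
  obtain ⟨_, ⟨⟨v', hv', rfl⟩, hvS'⟩, -⟩ := hcβ (Pi.single w' 1)
  have hvw' : res ℤ α v w' = 1 := by rw [hvS w' hw', Pi.single_eq_same]
  have hvw'' : res ℤ β v' w' = 1 := by rw [hvS' w' hw', Pi.single_eq_same]
  have h1 : 0 < res ℤ α v w := by
    have := hα S hS hSc w hw w' hw' hT _ ⟨v, hv, rfl⟩ (fun k hk => by
      rw [Finset.mem_insert, not_or] at hk
      rw [hvS k hk.2, Pi.single_eq_of_ne hk.1]) (by rw [hvw']; exact one_ne_zero)
    rwa [hvw', mul_one] at this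
  have h2 : 0 < res ℤ β v' w := by
    have := hβ S hS hSc w hw w' hw' hT _ ⟨v', hv', rfl⟩ (fun k hk => by
      rw [Finset.mem_insert, not_or] at hk
      rw [hvS' k hk.2, Pi.single_eq_of_ne hk.1]) (by rw [hvw'']; exact one_ne_zero)
    rwa [hvw'', mul_one] at this
  have hvj : res ℤ α v j = 0 := by rw [hvS j hjS, Pi.single_eq_of_ne hjw']
  have hvj' : res ℤ β v' j = 0 := by rw [hvS' j hjS, Pi.single_eq_of_ne hjw']
  -- eliminate `w'` from `c`
  let u := c - res ℤ α c w' • v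
  have hu : u ∈ M := M.sub_mem hc (M.smul_mem _ hv)
  have huα : ∀ k, res ℤ α u k = res ℤ α c k - res ℤ α c w' * res ℤ α v k := fun k => rfl
  have huβ : ∀ k, res ℤ β u k = res ℤ β c k - res ℤ α c w' * res ℤ β v k := fun k => rfl
  have husupp : ∀ k, k ∉ insert j S → res ℤ α u k = 0 := by
    intro k hk
    rw [Finset.mem_insert, not_or] at hk
    rw [huα]
    by_cases hkw' : k = w'
    · rw [hkw', hvw', mul_one, sub_self]
    · rw [hvS k hk.2, Pi.single_eq_of_ne hkw', mul_zero, sub_zero]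
      refine hsupp k ?_
      simp [hk.1, hkw', hk.2]
  have h3 := hP u hu husupp (by rwa [huα, hvj, mul_zero, sub_zero])
  rw [huα, hvj, mul_zero, sub_zero] at h3
  have hcw : res ℤ α c w = 0 := hsupp w (by simp [hwj, hww'])
  -- compare the relations of `β` on `S ∪ {w', j}`
  have h4 : res ℤ β (res ℤ β u j • v - res ℤ β u j • v' - res ℤ β v j • u) = 0 := by
    refine hcβ.eq_zero ⟨_, M.sub_mem (M.sub_mem (M.smul_mem _ hv) (M.smul_mem _ hv'))
      (M.smul_mem _ hu), rfl⟩ fun k hk => ?_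
    change res ℤ β u j * res ℤ β v k - res ℤ β u j * res ℤ β v' k - res ℤ β v j * res ℤ β u k = 0
    by_cases hkj : k = j
    · rw [hkj, hvj']
      ring
    · rw [hag v k hkj, hag u k hkj, hvS k hk, hvS' k hk, husupp k (by simp [hkj, hk])]
      ring
  have h5 := congrFun h4 w
  change res ℤ β u j * res ℤ β v w - res ℤ β u j * res ℤ β v' w - res ℤ β v j * res ℤ β u w = 0 at h5
  rw [hag v w hwj, hag u w hwj, huα w, hcw] at h5
  have h6 := huβ j
  have h7 : res ℤ α v w * res ℤ β c j = res ℤ β u j * res ℤ β v' w := by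
    linear_combination h5 - res ℤ α v w * h6
  have h8 : 0 < res ℤ α v w * (res ℤ α c j * res ℤ β c j) := by
    have : res ℤ α v w * (res ℤ α c j * res ℤ β c j) =
        (res ℤ α c j * res ℤ β u j) * res ℤ β v' w := by
      linear_combination res ℤ α c j * h7
    rw [this]
    exact mul_pos h3 h2
  exact (pos_iff_pos_of_mul_pos h8).1 h1

theorem pos_of_mul_pos_of_mul_pos {R : Type} [CommRing R] [LinearOrder R] [IsStrictOrderedRing R]
    {a b c : R} (hb : 0 < a * b) (hc : 0 < a * c) : 0 < b * c := by
  have h : 0 < (a * a) * (b * c) := by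
    have := mul_pos hb hc
    linear_combination this
  exact (pos_iff_pos_of_mul_pos h).1 (lt_of_le_of_ne (mul_self_nonneg a) fun h0 => by
    rw [← h0, zero_mul] at h
    exact lt_irrefl _ h)

variable [Fintype V]

/-- Opposite sides at all walls of `K(J)` follow from the same property of all projections to `K`.
The walls of `K(J)` that are seen by no projection separate two facets over the same facet of `K`;
they are handled by going to a facet where the sign is known, through the walls of `K`. -/
theorem IsOpposite.multiWedge {x : V → Fin n → ℝ} (hx : IsCompleteFan K x)
    (hJ : ∀ i, 1 ≤ J i) (hvert : ∀ v, {v} ∈ K) {M : Submodule ℤ ((Σ i, Fin (J i)) → ℤ)}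
    (hinj : ∀ α : ∀ i, Fin (J i), ∀ c ∈ M, res ℤ α c = 0 → c = 0)
    (hcob : ∀ S ∈ K, S.card = n → ∀ α : ∀ i, Fin (J i), IsCobasis (M.map (res ℤ α)) S)
    (hopp : ∀ α : ∀ i, Fin (J i), IsOpposite n K (M.map (res ℤ α))) :
    IsOpposite (n + ∑ i, (J i - 1)) (K.multiWedge J) M := by
  have hn : ∀ S ∈ K, S.card ≤ n := fun S hS => hx.card_le hS
  intro F hF hFc w hw w' hw' hG c hc hsupp hne
  obtain ⟨S, hS, hSc, α, rfl⟩ := exists_eq_starFace hJ hn hF hFc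
  obtain ⟨i, a⟩ := w
  obtain ⟨hi', hw'eq⟩ := eq_slot_of_notMem_starFace hw'
  set i' := w'.1
  rw [hw'eq] at hG hne hsupp ⊢
  have hex := exchange_multiWedge hJ hn hSc hw hi' hG
  by_cases hi : i ∈ S
  · have hne' : i' ≠ i := by
      intro h
      exact hi' (h ▸ hi)
    -- the facet is also a join with `σ(β)`, and both vertices lie in the link of `σ(β)`
    let β := Function.update α i a
    have hβi' : slot β i' = slot α i' := by simp [slot, β, Function.update_of_ne hne']
    have hβi : slot β i = ⟨i, a⟩ := by simp [slot, β]
    have := hopp β S hS hSc i hi i' hi' (hex.1 hi) _ ⟨c, hc, rfl⟩ (fun k hk => ?_) ?_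
    · rw [LinearMap.funLeft_apply, LinearMap.funLeft_apply, hβi, hβi'] at this
      exact this
    · rw [Finset.mem_insert, not_or] at hk
      refine hsupp _ ?_
      rw [Finset.mem_insert, not_or, ← hβi', ← starFace_update_of_mem hi a, slot_mem_starFace]
      exact ⟨fun h => hk.1 (slot_injective _ h), hk.2⟩
    · rw [LinearMap.funLeft_apply, hβi']
      exact hne
  · have hii' := hex.2 hi
    clear_value i'
    subst hii'
    let β := Function.update α i' a
    have hαβ : ∀ k, k ≠ i' → β k = α k := fun k hk => Function.update_of_ne hk _ _
    have hag : ∀ (d : (Σ i, Fin (J i)) → ℤ) k, k ≠ i' → res ℤ β d k = res ℤ α d k :=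
      fun d k hk => by rw [res_apply, res_apply, hαβ k hk]
    let P : Finset V → Prop := fun S => i' ∈ S ∨
      ∀ c ∈ M, (∀ k, k ∉ insert i' S → res ℤ α c k = 0) → res ℤ α c i' ≠ 0 →
        0 < res ℤ α c i' * res ℤ β c i'
    have hP : P S := by
      refine hx.facet_induction ?_ ?_ hS hSc
      · obtain ⟨T, hT, hvT, hTc⟩ := hx.pure (hvert i')
        exact ⟨T, hT, hTc, Or.inl (hvT (Finset.mem_singleton_self _))⟩
      · intro T hT hTc hPT v hv v' hv' hT'
        by_cases hj : i' ∈ insert v' (T.erase v)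
        · exact Or.inl hj
        right
        rw [Finset.mem_insert, not_or, Finset.mem_erase, not_and_or, not_not] at hj
        by_cases hjT : i' ∈ T
        · -- `T` contains `i'`, so the wall is seen both by `α` and by `β`
          have hvi : i' = v := hj.2.resolve_right fun h => h hjT
          subst hvi
          intro d hd hds hdj
          have hT'c : (insert v' (T.erase i')).card = n := by rw [card_exchange hv hv', hTc]
          have hnot : i' ∉ insert v' (T.erase i') := by simp [hj.1]
          have hback : insert i' ((insert v' (T.erase i')).erase v') = T := by
            rw [Finset.erase_insert fun h => hv' (Finset.mem_of_mem_erase h),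
              Finset.insert_erase hv]
          have hdsβ : ∀ k, k ∉ insert i' (insert v' (T.erase i')) → res ℤ β d k = 0 := by
            intro k hk
            rw [hag d k (fun h => hk (by rw [h]; exact Finset.mem_insert_self _ _))]
            exact hds k hk
          have h1 := hopp α _ hT' hT'c v' (Finset.mem_insert_self _ _) i' hnot
            (by rwa [hback]) _ ⟨d, hd, rfl⟩ hds hdj
          have h2 := hopp β _ hT' hT'c v' (Finset.mem_insert_self _ _) i' hnot
            (by rwa [hback]) _ ⟨d, hd, rfl⟩ hdsβ (by
              intro h0
              have := (hcob _ hT' hT'c β).eq_zero ⟨d, hd, rfl⟩ fun k hk => by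
                by_cases hki : k = i'
                · rw [hki]
                  exact h0
                · exact hdsβ k (by simp only [Finset.mem_insert, hki, false_or]
                                   simpa using hk)
              rw [hinj β d hd this] at hdj
              exact hdj rfl)
          rw [hag d v' (Ne.symm hj.1)] at h2
          exact pos_of_mul_pos_of_mul_pos h1 h2
        · exact pos_of_exchange hαβ (hopp α) (hopp β) hT hTc (hcob T hT hTc α)
            (hcob T hT hTc β) hv hv' hT' hjT hj.1 (hPT.resolve_left hjT)
    have h := hP.resolve_left hi c hc (fun k hk => ?_) hne
    · rw [mul_comm]
      have hβ : res ℤ β c i' = c ⟨i', a⟩ := by rw [res_apply, show β i' = a from Function.update_self _ _ _]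
      rw [hβ] at h
      exact h
    · rw [Finset.mem_insert, not_or] at hk
      refine hsupp _ ?_
      rw [Finset.mem_insert, not_or, slot_mem_starFace]
      exact ⟨fun h => hk.1 (slot_injective _ h), hk.2⟩

end Opposite


/-! ### Positive orientations -/

section Orientation

variable {V : Type} {n : ℕ} {K : Cpx V}

theorem map_univ_eq_exchange [DecidableEq V] {s t : Fin n ↪ V} {i : Fin n} (h : ∀ j, j ≠ i → s j = t j) :
    Finset.univ.map t = insert (t i) ((Finset.univ.map s).erase (s i)) := by
  ext v
  simp only [Finset.mem_map, Finset.mem_univ, true_and, Finset.mem_insert, Finset.mem_erase]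
  constructor
  · rintro ⟨j, rfl⟩
    by_cases hj : j = i
    · exact Or.inl (by rw [hj])
    · exact Or.inr ⟨fun h' => hj (s.injective ((h j hj).trans h')), j, h j hj⟩
  · rintro (rfl | ⟨hv, j, rfl⟩)
    · exact ⟨i, rfl⟩
    · exact ⟨j, (h j fun hj => hv (by rw [hj])).symm⟩

theorem notMem_map_univ {s t : Fin n ↪ V} {i : Fin n} (hi : s i ≠ t i)
    (h : ∀ j, j ≠ i → s j = t j) : t i ∉ Finset.univ.map s := by
  simp only [Finset.mem_map, Finset.mem_univ, true_and, not_exists]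
  intro j hj
  by_cases hji : j = i
  · rw [hji] at hj
    exact hi hj
  · rw [h j hji] at hj
    exact hji (t.injective hj)

theorem exists_enumeration {F : Finset V} (hc : F.card = n) :
    ∃ s : Fin n ↪ V, Finset.univ.map s = F := by
  refine ⟨(F.equivFinOfCardEq hc).symm.toEmbedding.trans (Function.Embedding.subtype _), ?_⟩
  ext v
  simp only [Finset.mem_map, Finset.mem_univ, true_and]
  constructor
  · rintro ⟨i, rfl⟩
    exact ((F.equivFinOfCardEq hc).symm i).2
  · intro hv
    exact ⟨F.equivFinOfCardEq hc ⟨v, hv⟩, by simp⟩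

theorem det_ne_zero_of_isCharacteristic {l : V → Fin n → ℤ} (hl : IsCharacteristic K l)
    {s : Fin n ↪ V} (hs : Finset.univ.map s ∈ K) : Matrix.det (fun k => l (s k)) ≠ 0 := by
  intro h0
  obtain ⟨v, hv, hv0⟩ := Matrix.exists_vecMul_eq_zero_iff.2 h0
  refine hv ?_
  have hli := (hl _ hs (by simp)).1
  have hli' : LinearIndependent ℤ (fun k => l (s k)) := by
    let e : Fin n → (Finset.univ.map s : Finset V) :=
      fun k => ⟨s k, Finset.mem_map_of_mem s (Finset.mem_univ k)⟩
    exact hli.comp e fun a b hab => s.injective (congrArg Subtype.val hab)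
  rw [Fintype.linearIndependent_iff] at hli'
  refine funext (hli' v ?_)
  rw [← hv0]
  funext j
  simp [Matrix.vecMul, dotProduct]

variable [Fintype V] [DecidableEq V]

/-- Cramer's rule for two adjacent ordered facets. -/
theorem det_exchange {l : V → Fin n → ℤ} {s t : Fin n ↪ V} {i : Fin n} (hi : s i ≠ t i)
    (h : ∀ j, j ≠ i → s j = t j) {c : V → ℤ} (hc : c ∈ rel ℤ l)
    (hs : ∀ v, v ∉ insert (t i) (Finset.univ.map s) → c v = 0) :
    c (t i) * Matrix.det (fun k => l (t k)) = -c (s i) * Matrix.det (fun k => l (s k)) := by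
  have hrow : Matrix.of (fun k => l (t k)) =
      (Matrix.of fun k => l (s k)).updateRow i (l (t i)) := by
    ext k m
    by_cases hk : k = i
    · subst hk
      simp
    · simp [Matrix.updateRow_ne hk, h k hk]
  have hsum : c (t i) • l (t i) = ∑ k, (-c (s k)) • Matrix.of (fun k => l (s k)) k := by
    rw [mem_rel, sum_eq_sum_of_supported hs, Finset.sum_insert (notMem_map_univ hi h),
      Finset.sum_map] at hc
    rw [eq_neg_of_add_eq_zero_left hc, ← Finset.sum_neg_distrib]
    exact Finset.sum_congr rfl fun k _ => (neg_smul _ _).symm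
  change c (t i) * Matrix.det (Matrix.of fun k => l (t k)) =
    -c (s i) * Matrix.det (Matrix.of fun k => l (s k))
  rw [hrow, ← Matrix.det_updateRow_smul, hsum]
  exact Matrix.det_updateRow_sum _ i fun k => -c (s k)

theorem IsPositivelyOriented.isOpposite {l : V → Fin n → ℤ} (h : IsPositivelyOriented K l) :
    IsOpposite n K (rel ℤ l) := by
  intro F hF hFc w hw w' hw' hG c hc hs hne
  obtain ⟨ε, hε, hpos⟩ := h
  obtain ⟨s, rfl⟩ := exists_enumeration hFc
  obtain ⟨i, -, rfl⟩ := Finset.mem_map.1 hw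
  have hinj : Function.Injective (Function.update s i w') := by
    intro j k hjk
    by_cases hj : j = i <;> by_cases hk : k = i
    · rw [hj, hk]
    · subst hj
      rw [Function.update_self, Function.update_of_ne hk] at hjk
      exact absurd (Finset.mem_map.2 ⟨k, Finset.mem_univ k, hjk.symm⟩) hw'
    · subst hk
      rw [Function.update_self, Function.update_of_ne hj] at hjk
      exact absurd (Finset.mem_map.2 ⟨j, Finset.mem_univ j, hjk⟩) hw'
    · rw [Function.update_of_ne hk, Function.update_of_ne hj] at hjk
      exact s.injective hjk
  let t : Fin n ↪ V := ⟨Function.update s i w', hinj⟩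
  have hti : t i = w' := Function.update_self _ _ _
  have hst : ∀ j, j ≠ i → s j = t j := fun j hj => (Function.update_of_ne hj _ _).symm
  have hne' : s i ≠ t i := by
    rw [hti]
    rintro h
    exact hw' (h ▸ hw)
  have htK : Finset.univ.map t ∈ K := by
    rw [map_univ_eq_exchange hst, hti]
    exact hG
  have hdet := det_exchange hne' hst hc (by rwa [hti])
  rw [hti] at hdet
  have h1 := hpos s hF
  have h2 := hpos t htK
  rw [hε.adjacent s t hF htK i hne' hst, Units.val_neg] at h2
  have hsq : (ε s : ℤ) * (ε s : ℤ) = 1 := Int.units_coe_mul_self (ε s)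
  have hneg : 0 < -(Matrix.det (fun k => l (s k)) * Matrix.det (fun k => l (t k))) := by
    linear_combination mul_pos h1 h2 -
      Matrix.det (fun k => l (s k)) * Matrix.det (fun k => l (t k)) * hsq
  have hpos' : 0 < (Matrix.det (fun k => l (s k)) * Matrix.det (fun k => l (s k))) *
      (c (s i) * c w') := by
    linear_combination mul_pos (mul_self_pos.2 hne) hneg -
      Matrix.det (fun k => l (s k)) * c w' * hdet
  exact (pos_iff_pos_of_mul_pos hpos').1 (mul_self_pos.2 (right_ne_zero_of_mul h1.ne'))

/-- For a characteristic map, the signs of the determinants are the only candidate for an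
orientation, and being an orientation is a condition on pairs of adjacent facets. -/
theorem IsOpposite.isPositivelyOriented {l : V → Fin n → ℤ} (hl : IsCharacteristic K l)
    (h : IsOpposite n K (rel ℤ l)) : IsPositivelyOriented K l := by
  have hdet := fun s => det_ne_zero_of_isCharacteristic (s := s) hl
  let D : (Fin n ↪ V) → ℤ := fun s => Matrix.det (fun k => l (s k))
  let ε : (Fin n ↪ V) → ℤˣ := fun s => if 0 < D s then 1 else -1
  have hεp : ∀ s, 0 < D s → ε s = 1 := fun s hs => if_pos hs
  have hεn : ∀ s, D s < 0 → ε s = -1 := fun s hs => if_neg hs.not_gt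
  refine ⟨ε, ⟨fun s hs π => ?_, fun s t hs ht i hi hst => ?_⟩, fun s hs => ?_⟩
  · have hπ : D (π.toEmbedding.trans s) = Equiv.Perm.sign π * D s :=
      Matrix.det_permute π (fun k => l (s k) : Matrix (Fin n) (Fin n) ℤ)
    rcases Int.units_eq_one_or (Equiv.Perm.sign π) with h1 | h1
    · rw [h1, Units.val_one, one_mul] at hπ
      rw [h1, one_mul]
      simp only [ε, hπ]
    · rw [h1, Units.val_neg, Units.val_one, neg_one_mul] at hπ
      rw [h1, neg_one_mul]
      rcases lt_or_gt_of_ne (hdet s hs) with hn | hp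
      · rw [hεn s hn, hεp _ (by rw [hπ]; exact neg_pos.2 hn), neg_neg]
      · rw [hεp s hp, hεn _ (by rw [hπ]; exact neg_neg_of_pos hp)]
  · have hcob := isCobasis_of_isCharacteristic hl hs (by simp)
    have hti := notMem_map_univ hi hst
    obtain ⟨c, ⟨hc, hcs⟩, -⟩ := hcob (Pi.single (t i) 1)
    have hct : c (t i) = 1 := by rw [hcs _ hti, Pi.single_eq_same]
    have hsupp : ∀ v, v ∉ insert (t i) (Finset.univ.map s) → c v = 0 := fun v hv => by
      rw [Finset.mem_insert, not_or] at hv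
      rw [hcs v hv.2, Pi.single_eq_of_ne hv.1]
    have hpos := h _ hs (by simp) (s i) (Finset.mem_map_of_mem s (Finset.mem_univ i)) (t i) hti
      (by rwa [← map_univ_eq_exchange hst]) c hc hsupp (by rw [hct]; exact one_ne_zero)
    have hD : D t = -c (s i) * D s := by
      have := det_exchange hi hst hc hsupp
      rwa [hct, one_mul] at this
    rw [hct, mul_one] at hpos
    rcases lt_or_gt_of_ne (hdet s hs) with hn | hp
    · rw [hεn s hn, hεp t (by rw [hD, neg_mul, ← mul_neg]; exact mul_pos hpos (neg_pos.2 hn)),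
        neg_neg]
    · rw [hεp s hp, hεn t (by rw [hD, neg_mul]; exact neg_neg_of_pos (mul_pos hpos hp))]
  · rcases lt_or_gt_of_ne (hdet s hs) with hn | hp
    · rw [hεn s hn, Units.val_neg, Units.val_one, neg_one_mul]
      exact neg_pos.2 hn
    · rw [hεp s hp, Units.val_one, one_mul]
      exact hp

end Orientation

/-! ### From integral to real vectors -/

section Real

variable {V : Type} {n : ℕ}

/-- The real vectors with the given integral coordinates. -/
def realVec (l : V → Fin n → ℤ) : V → Fin n → ℝ := fun v i => (l v i : ℝ)

theorem sum_smul_realVec [Fintype V] (l : V → Fin n → ℤ) (c : V → ℤ) :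
    ∑ v, (c v : ℝ) • realVec l v = fun i => (((∑ v, c v • l v) i : ℤ) : ℝ) := by
  funext i
  simp [realVec]

variable [Fintype V] {K : Cpx V}

theorem linearIndependent_realVec {l : V → Fin n → ℤ} {F : Finset V} (hc : F.card = n)
    (hF : Submodule.span ℤ (l '' (F : Set V)) = ⊤) :
    LinearIndependent ℝ (fun v : F => realVec l v) := by
  refine linearIndependent_of_top_le_span_of_card_eq_finrank ?_ (by simp [hc])
  have himg : Set.range (fun v : F => realVec l v) = realVec l '' (F : Set V) := by
    rw [Set.image_eq_range]
    rfl
  rw [himg]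
  intro y _
  rw [pi_eq_sum_univ' y]
  refine Submodule.sum_mem _ fun i _ => Submodule.smul_mem _ _ ?_
  have hmem : (Pi.single i 1 : Fin n → ℤ) ∈ Submodule.span ℤ (l '' (F : Set V)) :=
    hF ▸ Submodule.mem_top
  obtain ⟨c, hcF, hcs⟩ := (mem_span_image_iff_supported F l _).1 hmem
  refine (mem_span_image_iff_supported F (realVec l) _).2 ⟨fun v => (c v : ℝ),
    fun v hv => by simp [hcF v hv], ?_⟩
  rw [sum_smul_realVec, hcs]
  funext j
  by_cases hj : j = i
  · subst hj
    simp
  · simp [hj]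

variable [DecidableEq V]

theorem coord_of_rel {l : V → Fin n → ℤ} {F : Finset V}
    (hF : LinearIndependent ℝ (fun v : F => realVec l v)) {w w' : V} (hw : w ∈ F) (hw' : w' ∉ F)
    {c : V → ℤ} (hc : c ∈ rel ℤ l) (hs : ∀ v, v ∉ insert w' F → c v = 0) :
    (c w : ℝ) = -((c w' : ℝ) * coord (realVec l) F (realVec l w') w) := by
  have h0 : ∑ v, (c v : ℝ) • realVec l v = 0 := by
    rw [sum_smul_realVec, mem_rel.1 hc]
    funext i
    simp
  have h1 : ∑ v, (c v : ℝ) • realVec l v =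
      ∑ v, (if v = w' then (0 : ℝ) else c v) • realVec l v + (c w' : ℝ) • realVec l w' := by
    rw [← Finset.sum_erase_add _ _ (Finset.mem_univ w')]
    congr 1
    rw [← Finset.sum_erase_add (s := Finset.univ)
      (f := fun v => (if v = w' then (0 : ℝ) else c v) • realVec l v) (Finset.mem_univ w')]
    simp only [if_true, zero_smul, add_zero]
    exact Finset.sum_congr rfl fun v hv => by rw [if_neg (Finset.ne_of_mem_erase hv)]
  have h2 := coord_sum hF (a := fun v => if v = w' then (0 : ℝ) else c v) fun v hv => by
    by_cases h : v = w'
    · simp [h]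
    · have := hs v (by simp [h, hv])
      simp [this]
  have h3 : coord (realVec l) F (∑ v, (c v : ℝ) • realVec l v) w = 0 := by rw [h0]; simp
  rw [h1, map_add, h2, Pi.add_apply, if_neg (by rintro rfl; exact hw' hw), map_smul,
    Pi.smul_apply, smul_eq_mul] at h3
  linarith

theorem IsLocalFan.isOpposite {l : V → Fin n → ℤ} (h : IsLocalFan K (realVec l)) :
    IsOpposite n K (rel ℤ l) := by
  intro F hF hFc w hw w' hw' hG c hc hs hne
  have h1 := coord_of_rel (h.indep F hF hFc) hw hw' hc hs
  have h2 := h.opposite F hF hFc w hw w' hw' hG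
  have h3 : (0 : ℝ) < (c w : ℝ) * (c w' : ℝ) := by
    rw [h1]
    have h4 : 0 < (c w' : ℝ) * (c w' : ℝ) := mul_self_pos.2 (Int.cast_ne_zero.2 hne)
    have h5 := mul_pos h4 (neg_pos.2 h2)
    linear_combination h5
  exact_mod_cast h3

theorem IsOpposite.isLocalFan {l : V → Fin n → ℤ} (hl : IsCharacteristic K l)
    (h : IsOpposite n K (rel ℤ l)) : IsLocalFan K (realVec l) where
  indep F hF hc := linearIndependent_realVec hc (hl F hF hc).2
  opposite F hF hFc w hw w' hw' hG := by
    have hind := linearIndependent_realVec hFc (hl F hF hFc).2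
    obtain ⟨c, ⟨hc, hcs⟩, -⟩ := isCobasis_of_isCharacteristic hl hF hFc (Pi.single w' 1)
    have hc1 : c w' = 1 := by rw [hcs _ hw', Pi.single_eq_same]
    have hsupp : ∀ v, v ∉ insert w' F → c v = 0 := fun v hv => by
      rw [Finset.mem_insert, not_or] at hv
      rw [hcs v hv.2, Pi.single_eq_of_ne hv.1]
    have h1 := h F hF hFc w hw w' hw' hG c hc hsupp (by rw [hc1]; exact one_ne_zero)
    have h2 := coord_of_rel hind hw hw' hc hsupp
    rw [hc1, mul_one] at h1
    rw [hc1, Int.cast_one, one_mul] at h2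
    have h3 : (0 : ℝ) < (c w : ℝ) := by exact_mod_cast h1
    linarith

theorem exists_real_linearMap {N : ℕ} (π : (Fin N → ℤ) →ₗ[ℤ] (Fin n → ℤ)) :
    ∃ πr : (Fin N → ℝ) →ₗ[ℝ] (Fin n → ℝ), ∀ v : Fin N → ℤ,
      πr (fun i => (v i : ℝ)) = fun i => ((π v i : ℤ) : ℝ) := by
  refine ⟨((LinearMap.toMatrix' π).map (Int.castRingHom ℝ)).mulVecLin, fun v => ?_⟩
  funext i
  rw [Matrix.mulVecLin_apply]
  have := RingHom.map_mulVec (Int.castRingHom ℝ) (LinearMap.toMatrix' π) v i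
  rw [LinearMap.toMatrix'_mulVec] at this
  exact this.symm

end Real

/-! ### The covering number over `K(J)` -/

section FanLifting

open MeasureTheory Filter Topology

variable {V : Type} [Fintype V] [DecidableEq V] {n : ℕ} {K : Cpx V} {J : V → ℕ}

/-- The vertices of `σ(α)` over the vertices of `K` outside `U`. -/
def partialComplFace (α : ∀ i, Fin (J i)) (U : Finset V) : Finset (Σ i, Fin (J i)) :=
  Finset.univ.filter fun x => x.1 ∉ U ∧ x.2 ≠ α x.1

theorem mem_partialComplFace {α : ∀ i, Fin (J i)} {U : Finset V} {x : Σ i, Fin (J i)} :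
    x ∈ partialComplFace α U ↔ x.1 ∉ U ∧ x.2 ≠ α x.1 := by
  simp [partialComplFace]

theorem starFace_eq_of_complFace_subset {S : Finset V} {α β : ∀ i, Fin (J i)}
    (h : partialComplFace α ∅ ⊆ starFace S β) : starFace S β = starFace S α := by
  have hag : ∀ k, k ∉ S → β k = α k := fun k hk => by
    by_contra hne
    exact hk (slot_mem_starFace.1 (h (mem_partialComplFace.2 ⟨Finset.notMem_empty k, hne⟩)))
  ext ⟨k, c⟩
  rw [mem_starFace, mem_starFace]
  by_cases hk : k ∈ S
  · simp [hk]
  · simp only [hk, false_or, hag k hk]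

/-- The cones of a local fan over `K(J)` cover a generic vector at most once if the projection to
`K` with respect to one face `σ(α)` is a complete fan. Starting from the star of `σ(α)`, the
vertices `i_a` with `a ≠ α i` are released for one `i` after the other: a vector far in the direction
opposite to `i_{α i}` is not covered by any cone that contains `i_{α i}`, and a facet that does not
contain `i_{α i}` contains all other `i_a`. -/
theorem coverCount_le_one (hJ : ∀ i, 1 ≤ J i) (hK : IsPseudomanifold n K) {N : ℕ}
    (hN : N = n + ∑ i, (J i - 1))
    {X : (Σ i, Fin (J i)) → Fin N → ℝ} (hX : IsLocalFan (K.multiWedge J) X)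
    {α : ∀ i, Fin (J i)} {x : V → Fin n → ℝ} (hx : IsCompleteFan K x)
    {π : (Fin N → ℝ) →ₗ[ℝ] (Fin n → ℝ)} (hπ : ∀ i, π (X (slot α i)) = x i)
    (hπ0 : ∀ w, (∀ i, slot α i ≠ w) → π (X w) = 0) (U : Finset V) {y : Fin N → ℝ}
    (hy : IsGeneric X (partialComplFace α U)
      (facetsThrough N (K.multiWedge J) (partialComplFace α U)) y) :
    coverCount X (partialComplFace α U)
      (facetsThrough N (K.multiWedge J) (partialComplFace α U)) y ≤ 1 := by
  classical
  have hKJ : IsPseudomanifold N (K.multiWedge J) := by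
    rw [hN]
    exact hK.multiWedge hJ
  have hcross := hX.isCrossing hKJ
  induction U using Finset.induction_on generalizing y with
  | empty =>
    have key : ∀ F ∈ facetsThrough N (K.multiWedge J) (partialComplFace α ∅),
        Inside X (partialComplFace α ∅) F y →
          ∃ S ∈ K, S.card = n ∧ F = starFace S α ∧ Inside x ∅ S (π y) := by
      intro F hF hFy
      have hFb := (hcross _).basis F hF
      rw [mem_facetsThrough] at hF
      obtain ⟨S, hS, hSc, β, rfl⟩ := exists_eq_starFace hJ hK.card_le hF.1
        (hF.2.1.trans hN)
      have heq := starFace_eq_of_complFace_subset hF.2.2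
      rw [heq] at hFy hFb
      refine ⟨S, hS, hSc, heq, fun i hi _ => ?_⟩
      have hsum : π y = ∑ i, coord X (starFace S α) y (slot α i) • x i := by
        conv_lhs => rw [← hFb.sum_coord y, map_sum]
        simp only [map_smul]
        rw [sum_eq_sum_comp_add (slot_injective α) mem_complFace_iff_slot
          (x := fun w => π (X w))]
        simp only [hπ]
        rw [Finset.sum_eq_zero (s := complFace α) fun w hw => by
          rw [hπ0 w ((mem_complFace_iff_slot w).1 hw), smul_zero], add_zero]
      rw [hsum, coord_sum (hx.linearIndependent S hS) fun k hk =>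
        coord_of_notMem y fun h => hk (slot_mem_starFace.1 h)]
      exact hFy _ (slot_mem_starFace.2 hi) (by simp [mem_partialComplFace])
    refine Finset.card_le_one.2 fun F hF G hG => ?_
    obtain ⟨hF, hFy⟩ := Finset.mem_filter.1 hF
    obtain ⟨hG, hGy⟩ := Finset.mem_filter.1 hG
    obtain ⟨S, hS, hSc, rfl, hSy⟩ := key F hF hFy
    obtain ⟨T, hT, hTc, rfl, hTy⟩ := key G hG hGy
    rw [hx.inside_unique hS hSc hT hTc hSy hTy]
  | insert i U hi ih =>
    let A := partialComplFace α U
    let A' := partialComplFace α (insert i U)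
    have hA'A : A' ⊆ A := fun w hw => by
      rw [mem_partialComplFace] at hw ⊢
      exact ⟨fun h => hw.1 (Finset.mem_insert_of_mem h), hw.2⟩
    have hwA' : slot α i ∉ A' := by simp [A', mem_partialComplFace]
    let X' := X (slot α i)
    obtain ⟨t, ht⟩ : ∃ t : ℝ, ∀ F, F ∈ facetsThrough N (K.multiWedge J) A' → ∀ v, v ∈ F → v ∉ A' →
        coord X F (y - t • X') v ≠ 0 ∧ (v = slot α i → coord X F (y - t • X') v < 0) := by
      refine (show ∀ᶠ t : ℝ in atTop, _ from eventually_all.2 fun F => ?_).exists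
      by_cases hF : F ∈ facetsThrough N (K.multiWedge J) A'
      · refine Eventually.mono (eventually_all.2 fun v => ?_) fun t h _ => h
        by_cases hv : v ∈ F ∧ v ∉ A'
        · have h0 := hy F hF v hv.1 hv.2
          have hcoord : ∀ t : ℝ, coord X F (y - t • X') v = coord X F y v - t * coord X F X' v :=
            fun t => by simp
          filter_upwards [eventually_gt_atTop (coord X F y v / coord X F X' v),
            eventually_gt_atTop (coord X F y v)] with t ht1 ht2 hvF _
          rw [hcoord]
          constructor
          · intro h
            by_cases hq : coord X F X' v = 0
            · rw [hq] at h
              exact h0 (by linarith)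
            · rw [sub_eq_zero, ← div_eq_iff hq] at h
              exact ht1.ne h
          · rintro rfl
            have hself := congrFun (coord_self ((hcross A').basis F hF).indep hvF) (slot α i)
            rw [Pi.single_eq_same] at hself
            change coord X F X' (slot α i) = 1 at hself
            rw [hself]
            linarith
        · exact Eventually.of_forall fun t h1 h2 => absurd ⟨h1, h2⟩ hv
      · exact Eventually.of_forall fun t h => absurd h hF
    have hgen' : IsGeneric X A' (facetsThrough N (K.multiWedge J) A') (y - t • X') :=
      fun F hF v hv hvA => (ht F hF v hv hvA).1
    have hgen : IsGeneric X A (facetsThrough N (K.multiWedge J) A) (y - t • X') := by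
      intro F hF v hv hvA
      rw [mem_facetsThrough] at hF
      exact (ht F (mem_facetsThrough.2 ⟨hF.1, hF.2.1, hA'A.trans hF.2.2⟩) v hv
        fun h => hvA (hA'A h)).1
    rw [(hcross A').coverCount_eq hy hgen']
    refine le_trans (Finset.card_le_card fun F hF => ?_) (ih hgen)
    obtain ⟨hF, hFy⟩ := Finset.mem_filter.1 hF
    refine Finset.mem_filter.2 ⟨?_, fun v hv hvA => hFy v hv fun h => hvA (hA'A h)⟩
    have hwF : slot α i ∉ F := fun h =>
      lt_asymm (hFy _ h hwA') ((ht F hF _ h hwA').2 rfl)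
    rw [mem_facetsThrough] at hF ⊢
    refine ⟨hF.1, hF.2.1, fun w hw => ?_⟩
    obtain ⟨k, c⟩ := w
    by_cases hk : k = i
    · subst hk
      obtain ⟨S, -, -, β, rfl⟩ := exists_eq_starFace hJ hK.card_le hF.1
        (hF.2.1.trans hN)
      rw [mem_starFace, not_or, not_not] at hwF
      have h1 := hwF.2
      simp only at h1
      rw [mem_starFace]
      right
      simp only
      rw [← h1]
      exact (mem_partialComplFace.1 hw).2
    · refine hF.2.2 (mem_partialComplFace.2 ⟨?_, (mem_partialComplFace.1 hw).2⟩)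
      rw [Finset.mem_insert, not_or]
      exact ⟨hk, (mem_partialComplFace.1 hw).1⟩

end FanLifting

/-! ### Lifting the four categories to `K(J)` -/

section Lifting

variable {V : Type} [Fintype V] {n : ℕ} {K : Cpx V}

theorem lifts_of_isCharacteristic {R : Type} [CommRing R] {C : CharCat R}
    (hC : ∀ (W : Type) (N : ℕ) (L : Cpx W) l, IsCharacteristic L l → C W N L l) : Lifts C n K :=
  fun _ _ L hL _ _ => hC _ _ _ L hL

variable [DecidableEq V]

theorem hasFacets_of_isCompleteFan {x : V → Fin n → ℝ} (hx : IsCompleteFan K x)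
    (hvert : ∀ v, {v} ∈ K) : HasFacets n K where
  card_le _ hS := hx.card_le hS
  exists_mem v := by
    obtain ⟨F, hF, hvF, hc⟩ := hx.pure (hvert v)
    exact ⟨F, hF, hvF (Finset.mem_singleton_self v), hc⟩
  nonempty := by
    obtain ⟨F, hF, -, hc⟩ := hx.pure hx.isPseudomanifold.empty_mem
    exact ⟨F, hF, hc⟩

theorem isOpposite_multiWedge_of_projections {x : V → Fin n → ℝ} (hx : IsCompleteFan K x)
    (hvert : ∀ v, {v} ∈ K) {J : V → ℕ} (hJ : ∀ i, 1 ≤ J i)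
    {L : (Σ i, Fin (J i)) → Fin (n + ∑ i, (J i - 1)) → ℤ}
    (hL : IsCharacteristic (K.multiWedge J) L)
    (h : ∀ α : ∀ i, Fin (J i), ∃ l : V → Fin n → ℤ, IsCharacteristic K l ∧
      IsOpposite n K (rel ℤ l) ∧ rel ℤ l = (rel ℤ L).map (res ℤ α)) :
    IsOpposite (n + ∑ i, (J i - 1)) (K.multiWedge J) (rel ℤ L) := by
  refine IsOpposite.multiWedge hx hJ hvert
    (fun α => res_injOn_rel (hasFacets_of_isCompleteFan hx hvert) hJ hL α)
    (fun S hS hSc α => ?_) fun α => ?_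
  · obtain ⟨l, hl, -, hrel⟩ := h α
    rw [← hrel]
    exact isCobasis_of_isCharacteristic hl hS hSc
  · obtain ⟨l, -, hl, hrel⟩ := h α
    rw [← hrel]
    exact hl

theorem lifts_posCat {x : V → Fin n → ℝ} (hx : IsCompleteFan K x) (hvert : ∀ v, {v} ∈ K) :
    Lifts posCat n K := by
  intro J hJ L hL _ h
  refine ⟨hL, (isOpposite_multiWedge_of_projections hx hvert hJ hL fun α => ?_).isPositivelyOriented
    hL⟩
  obtain ⟨l, hl, hrel⟩ := h α
  exact ⟨l, hl.1, hl.2.isOpposite, hrel⟩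

theorem lifts_fanCat {x : V → Fin n → ℝ} (hx : IsCompleteFan K x) (hvert : ∀ v, {v} ∈ K) :
    Lifts fanCat n K := by
  intro J hJ L hL hLs h
  have hopp := isOpposite_multiWedge_of_projections hx hvert hJ hL fun α => by
    obtain ⟨l, hl, hrel⟩ := h α
    exact ⟨l, hl.1, (IsCompleteFan.isLocalFan (x := realVec l) hl.2).isOpposite, hrel⟩
  have hloc := hopp.isLocalFan hL
  have hK := hx.isPseudomanifold
  refine ⟨hL, hloc.isCompleteFan (hK.multiWedge hJ) ?_⟩
  let α : ∀ i, Fin (J i) := fun i => ⟨0, hJ i⟩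
  obtain ⟨l, hl, hrel⟩ := h α
  obtain ⟨π, hπ, hπ0⟩ := exists_linearMap_of_rel_eq (slot_injective α) hLs hrel
  obtain ⟨πr, hπr⟩ := exists_real_linearMap π
  have hempty : partialComplFace α Finset.univ = ∅ := by
    ext w
    simp [mem_partialComplFace]
  obtain ⟨y, hy⟩ := (hloc.isCrossing (hK.multiWedge hJ) ∅).ae_isGeneric.exists
  refine ⟨y, hy, ?_⟩
  have := coverCount_le_one hJ hK rfl hloc (α := α) (x := realVec l) (π := πr) hl.2
    (fun i => (hπr _).trans (by rw [hπ]; rfl))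
    (fun w hw => (hπr _).trans (by rw [hπ0 w hw]; funext i; simp)) Finset.univ (y := y)
  rw [hempty] at this
  exact this hy

end Lifting

end ToricPuzzle

theorem theorem5p3 (m n : ℕ) (K : ToricPuzzle.Cpx (Fin m))
    (hK : ToricPuzzle.IsStarShapedSphere n K) (J : Fin m → ℕ) (hJ : ∀ i, 1 ≤ J i) :
    (∀ p : ToricPuzzle.Puzzle ToricPuzzle.intCat n K J,
      ToricPuzzle.Puzzle.IsRealizable p ↔ ToricPuzzle.Puzzle.SubsquaresRealizable p) ∧
    (∀ p : ToricPuzzle.Puzzle ToricPuzzle.posCat n K J,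
      ToricPuzzle.Puzzle.IsRealizable p ↔ ToricPuzzle.Puzzle.SubsquaresRealizable p) ∧
    (∀ p : ToricPuzzle.Puzzle ToricPuzzle.fanCat n K J,
      ToricPuzzle.Puzzle.IsRealizable p ↔ ToricPuzzle.Puzzle.SubsquaresRealizable p) ∧
    (∀ p : ToricPuzzle.Puzzle ToricPuzzle.modTwoCat n K J,
      ToricPuzzle.Puzzle.IsRealizable p ↔ ToricPuzzle.Puzzle.SubsquaresRealizable p) := by
  obtain ⟨hvert, x, hx⟩ := hK
  have hF := ToricPuzzle.hasFacets_of_isCompleteFan hx hvert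
  refine ⟨fun p => ?_, fun p => ?_, fun p => ?_, fun p => ?_⟩
  · exact p.isRealizable_iff hF (fun _ _ _ _ h => h)
      (ToricPuzzle.lifts_of_isCharacteristic fun _ _ _ _ h => h) hJ
  · exact p.isRealizable_iff hF (fun _ _ _ _ h => h.1) (ToricPuzzle.lifts_posCat hx hvert) hJ
  · exact p.isRealizable_iff hF (fun _ _ _ _ h => h.1) (ToricPuzzle.lifts_fanCat hx hvert) hJ
  · exact p.isRealizable_iff hF (fun _ _ _ _ h => h)
      (ToricPuzzle.lifts_of_isCharacteristic fun _ _ _ _ h => h) hJ
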